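/- Let $M_G=\langle\mathcal S_G,\mathcal A,\mathcal T_G,\mathcal R_G,\gamma\rangle$ be a finite MDP with rewards in $[0,1]$ and $\gamma\in[0,1)$. Let $\phi:\mathcal S_G\to\mathcal S_A$ be a surjective state aggregation and $\omega\ge 0$ a weighting summing to $1$ on each aggregate, and let $M_A$ be the abstract MDP with $\mathcal R_A(\bar s,a)=\sum_{\phi(g)=\bar s}\omega(g)\mathcal R_G(g,a)$ and $\mathcal T_A(\bar s,a,\bar s')=\sum_{\phi(g)=\bar s}\sum_{\phi(g')=\bar s'}\omega(g)\mathcal T_G(g,a,g')$. Write $V_G,V_A$ for the optimal values and $V_G^{\pi},V_A^{\pi}$ for policy values. Let $\eta>0$, and suppose that $\phi$ is an approximate abstraction of parameter $\eta$ (for some $f:\mathcal S_G\times\mathcal A\to\mathbb R$, $\phi(s_1)=\phi(s_2)$ implies $|f(s_1,a)-f(s_2,a)|\le\eta$ for all $a$) with sub-optimality bounded in $\eta$: there is a monotonically increasing $g$ with $g(0)=0$ such that, for all $s\in\mathcal S_G$ and all policies $\pi:\mathcal S_A\to[0,1]^{\mathcal A}$, $|V_G(s)-V_A(\phi(s))|\le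 g(\eta)$ and $|V_G^{\pi\circ\phi}(s)-V_A^{\pi}(\phi(s))|\le g(\eta)$. Let $0<\delta<1$ and let $0<\epsilon\le 1$ with $\epsilon\le g(\eta)$ (in particular $\epsilon=g(\eta)$ when $0<g(\eta)\le 1$). MBIE-EB with bonus constant $b$ and sample cap $c$, run in $M_A$, forms at each time the empirical rewards $\hat{\mathcal R}_A$ and transitions $\hat{\mathcal T}_A$ from the first $c$ experiences of each pair $(\bar s,a)$, lets $N(\bar s,a)$ be the number of experiences used, solves $$V(\bar s)=\max_{a}\Big[\hat{\mathcal R}_A(\bar s,a)+\gamma\sum_{\bar s'}\hat{\mathcal T}_A(\bar s'\mid\bar s,a)V(\bar s')+\frac{b}{\sqrt{N(\bar s,a)}}\Big]$$ (the bracket being replaced by $1/(1-\gamma)$ if $N(\bar s,a)=0$), and acts with the greedy policy $\tilde\pi_t:\mathcal S_A\to\mathcal A$ for this equation, ties being broken by a fixed rule. Call time $t$, with state $\bar s_t$, successful if $V_A(\bar s_t)-V_A^{\tilde\pi_t}(\bar s_t)\le\epsilon$ and $V_G(s)-V_G^{\tilde\pi_t\circ\phi}(s)\le 3g(\eta)$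 for every $s\in\mathcal S_G$ with $\phi(s)=\bar s_t$. There are universal constants $C>0$ and $k\in\mathbb N$ and an integer $m\ge 1$ depending only on $|\mathcal S_A|,|\mathcal A|,\epsilon,\delta,\gamma$, with $m\le C\ell^k\frac{|\mathcal S_A|}{\epsilon^2(1-\gamma)^4}$ where $\ell=\ln\frac{e|\mathcal S_A||\mathcal A|}{\epsilon\delta(1-\gamma)}$, such that the following holds with $$\beta=\frac1{1-\gamma}\sqrt{\tfrac12\ln\frac{2|\mathcal S_A||\mathcal A|m}{\delta}},\qquad T=C\,\ell^k\,\frac{|\mathcal S_A|^2|\mathcal A|}{\epsilon^3(1-\gamma)^6}=\tilde O\Big(\frac{|\mathcal S_A|^2|\mathcal A|}{\epsilon^3(1-\gamma)^6}\Big),$$ for every $p>0$, when MBIE-EB is run in $M_A$ with bonus $\sqrt p\,\beta/\sqrt{N(\bar s,a)}$. 1. If $p<1$ (under-exploration) and the cap is $m$, all but at most $T$ time steps are successful with probability at least $1-\frac\delta2-|\mathcal S_A||\mathcal A|m\big(\frac{\delta}{2|\mathcal S_A||\mathcal A|m}\big)^p$, and this guaranteed level is smaller than $1-\delta$. 2.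 If $p\ge1$ (over-exploration for $p>1$; $p=1$ is MBIE-EB itself) and the cap is $\lceil pm\rceil$, then with probability at least $1-\delta$ all but at most $p\,T$ time steps are successful, i.e. the sample complexity bound is multiplied by $p$. -/

import Mathlib

open scoped BigOperators

noncomputable section

/-! ### Markov decision processes -/

/-- A finite discounted MDP with rewards in `[0, 1]` and discount factor in `[0, 1)`. -/
structure MDP (S A : Type*) [Fintype S] where
  /-- transition probabilities: `T s a s'` is the probability of moving from `s` to `s'` under `a` -/
  T : S → A → S → ℝ
  /-- reward function -/
  R : S → A → ℝ
  /-- discount factor -/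
  γ : ℝ
  T_nonneg : ∀ s a s', 0 ≤ T s a s'
  T_sum : ∀ s a, ∑ s', T s a s' = 1
  R_nonneg : ∀ s a, 0 ≤ R s a
  R_le_one : ∀ s a, R s a ≤ 1
  γ_nonneg : 0 ≤ γ
  γ_lt_one : γ < 1

/-- Stationary stochastic policies `S → [0,1]^A`. -/
def IsPolicy {S A : Type*} [Fintype A] (π : S → A → ℝ) : Prop :=
  ∀ s, (∀ a, 0 ≤ π s a) ∧ ∑ a, π s a = 1

/-- A deterministic policy `S → A` seen as a stochastic one. -/
def detPolicy {S A : Type*} [DecidableEq A] (π : S → A) : S → A → ℝ :=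
  fun s => Pi.single (π s) 1

namespace MDP

variable {S A : Type*} [Fintype S] [Fintype A] [DecidableEq S]

/-- Transition matrix of the Markov chain induced by a policy. -/
def transMatrix (M : MDP S A) (π : S → A → ℝ) : Matrix S S ℝ :=
  Matrix.of fun s s' => ∑ a, π s a * M.T s a s'

/-- Expected one-step reward under a policy. -/
def policyReward (M : MDP S A) (π : S → A → ℝ) : S → ℝ :=
  fun s => ∑ a, π s a * M.R s a

/-- `V^π(s)`: the expected discounted return when starting in `s` and following `π`. -/
def value (M : MDP S A) (π : S → A → ℝ) (s : S) : ℝ :=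
  ∑' t : ℕ, M.γ ^ t * ((M.transMatrix π ^ t).mulVec (M.policyReward π)) s

/-- `V^*(s)`: the optimal value, the maximum of `V^π(s)` over the policies `π : S → A`. -/
def optValue [DecidableEq A] (M : MDP S A) (s : S) : ℝ :=
  ⨆ π : S → A, M.value (detPolicy π) s

end MDP

/-! ### State abstractions -/

/-- A state aggregation function `φ` from ground states onto abstract states, with a weighting `ω`
of the ground states that sums to one on each aggregate. -/
structure StateAbstraction (SG SA : Type*) [Fintype SG] [DecidableEq SA] where
  φ : SG → SA
  surj : Function.Surjective φ
  ω : SG → ℝ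
  ω_nonneg : ∀ s, 0 ≤ ω s
  ω_le_one : ∀ s, ω s ≤ 1
  ω_sum : ∀ s, ∑ g with φ g = φ s, ω g = 1

/-- The abstract MDP: convex combinations, with weights `ω`, of ground rewards and transitions. -/
def MDP.abstract {SG SA A : Type*} [Fintype SG] [Fintype SA] [DecidableEq SA]
    (M : MDP SG A) (α : StateAbstraction SG SA) : MDP SA A where
  T x a x' := ∑ g with α.φ g = x, ∑ g' with α.φ g' = x', α.ω g * M.T g a g'
  R x a := ∑ g with α.φ g = x, α.ω g * M.R g a
  γ := M.γ
  T_nonneg x a x' := Finset.sum_nonneg fun g _ => Finset.sum_nonneg fun g' _ =>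
    mul_nonneg (α.ω_nonneg g) (M.T_nonneg g a g')
  T_sum x a := by
    obtain ⟨s, rfl⟩ := α.surj x
    rw [Finset.sum_comm]
    simp_rw [Finset.sum_fiberwise, ← Finset.mul_sum, M.T_sum, mul_one]
    exact α.ω_sum s
  R_nonneg x a := Finset.sum_nonneg fun g _ => mul_nonneg (α.ω_nonneg g) (M.R_nonneg g a)
  R_le_one x a := by
    obtain ⟨s, rfl⟩ := α.surj x
    rw [← α.ω_sum s]
    exact Finset.sum_le_sum fun g _ => mul_le_of_le_one_right (α.ω_nonneg g) (M.R_le_one g a)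
  γ_nonneg := M.γ_nonneg
  γ_lt_one := M.γ_lt_one

/-- Approximate state abstraction: aggregated states have `f`-values within `η`. -/
def IsApproxAbstraction {SG SA A : Type*} (φ : SG → SA) (f : SG → A → ℝ) (η : ℝ) : Prop :=
  ∀ s₁ s₂, φ s₁ = φ s₂ → ∀ a, |f s₁ a - f s₂ a| ≤ η

/-- Sub-optimality bounded in `η`, witnessed by the increasing function `g`. -/
structure HasBoundedSuboptimality {SG SA A : Type*} [Fintype SG] [Fintype SA] [Fintype A]
    [DecidableEq SG] [DecidableEq SA] [DecidableEq A]
    (M : MDP SG A) (α : StateAbstraction SG SA) (g : ℝ → ℝ) (η : ℝ) : Prop where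
  mono : MonotoneOn g (Set.Ici 0)
  map_zero : g 0 = 0
  optimal : ∀ s, |M.optValue s - (M.abstract α).optValue (α.φ s)| ≤ g η
  policy : ∀ π : SA → A → ℝ, IsPolicy π →
    ∀ s, |M.value (fun s => π (α.φ s)) s - (M.abstract α).value π (α.φ s)| ≤ g η

/-! ### MBIE-EB

Below, `s : ℕ → S` and `a : ℕ → A` are the states and actions of a trajectory. The quantities at
time `t` only depend on `s 0, a 0, …, s (t-1), a (t-1), s t`. -/

section MBIEEB

variable {S A : Type*} [Fintype S] [DecidableEq S] [DecidableEq A]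

/-- Number of visits to `(x, u)` before time `t`. -/
def visitCount (s : ℕ → S) (a : ℕ → A) (t : ℕ) (x : S) (u : A) : ℕ :=
  ((Finset.range t).filter fun i => s i = x ∧ a i = u).card

/-- The times before `t` of the first (at most) `c` visits to `(x, u)`: the experiences of `(x, u)`
that the algorithm uses. -/
def sampleTimes (c : ℕ) (s : ℕ → S) (a : ℕ → A) (t : ℕ) (x : S) (u : A) : Finset ℕ :=
  (Finset.range t).filter fun i => (s i = x ∧ a i = u) ∧ visitCount s a i x u < c

/-- Number of experiences of `(x, u)` used at time `t`; this is `min (visitCount s a t x u) c`. -/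
def sampleCount (c : ℕ) (s : ℕ → S) (a : ℕ → A) (t : ℕ) (x : S) (u : A) : ℕ :=
  (sampleTimes c s a t x u).card

/-- Empirical reward: the average of the observed rewards. -/
def empReward (M : MDP S A) (c : ℕ) (s : ℕ → S) (a : ℕ → A) (t : ℕ) (x : S) (u : A) : ℝ :=
  (∑ i ∈ sampleTimes c s a t x u, M.R (s i) (a i)) / sampleCount c s a t x u

/-- Empirical transition probability: the frequency of `x'` among the observed next states. -/
def empTrans (c : ℕ) (s : ℕ → S) (a : ℕ → A) (t : ℕ) (x : S) (u : A) (x' : S) : ℝ :=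
  (((sampleTimes c s a t x u).filter fun i => s (i + 1) = x').card : ℝ) / sampleCount c s a t x u

/-- Right-hand side of the MBIE-EB equation for the pair `(x, u)` at time `t`, with bonus
`b / √n` for `n` experiences. A pair that was never tried has the maximal value `1 / (1 - γ)`. -/
def bonusBackup (M : MDP S A) (b : ℝ) (c : ℕ) (s : ℕ → S) (a : ℕ → A) (t : ℕ)
    (V : S → ℝ) (x : S) (u : A) : ℝ :=
  if sampleCount c s a t x u = 0 then 1 / (1 - M.γ)
  else empReward M c s a t x u + M.γ * ∑ x', empTrans c s a t x u x' * V x'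
    + b / Real.sqrt (sampleCount c s a t x u)

/-- The MBIE-EB equation at time `t` (for finite `A` and `γ < 1` it has exactly one solution). -/
def IsBonusValue (M : MDP S A) (b : ℝ) (c : ℕ) (s : ℕ → S) (a : ℕ → A) (t : ℕ)
    (V : S → ℝ) : Prop :=
  ∀ x, V x = ⨆ u, bonusBackup M b c s a t V x u

/-- A rule that selects a maximizing action, ties being broken in a fixed way. -/
def IsGreedyRule (tie : S → (A → ℝ) → A) : Prop :=
  ∀ (x : S) (q : A → ℝ) (u : A), q u ≤ q (tie x q)

/-- `s`, `a`, `π` are the states, the actions and the current policies of MBIE-EB executed on `M`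
(from any, possibly random, initial state) with bonus constant `b`, using the first `c` experiences
of each state-action pair. -/
structure IsMBIEEBRun {Ω : Type*} [MeasurableSpace Ω] (P : MeasureTheory.Measure Ω)
    (M : MDP S A) (b : ℝ) (c : ℕ) (tie : S → (A → ℝ) → A)
    (s : ℕ → Ω → S) (a : ℕ → Ω → A) (π : ℕ → Ω → S → A) : Prop where
  measurable_state : ∀ t x, MeasurableSet {ω | s t ω = x}
  /-- at each time the current policy is greedy for the solution of the MBIE-EB equation -/
  policy : ∀ t ω, ∃ V, IsBonusValue M b c (fun i => s i ω) (fun i => a i ω) t V ∧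
    ∀ x, π t ω x = tie x (bonusBackup M b c (fun i => s i ω) (fun i => a i ω) t V x)
  action : ∀ t ω, a t ω = π t ω (s t ω)
  /-- given the history up to time `t`, the next state is drawn from the transition function -/
  transition : ∀ (t : ℕ) (x : ℕ → S) (u : ℕ → A) (x' : S),
    P.real {ω | (∀ i ≤ t, s i ω = x i ∧ a i ω = u i) ∧ s (t + 1) ω = x'} =
      P.real {ω | ∀ i ≤ t, s i ω = x i ∧ a i ω = u i} * M.T (x t) (u t) x'

end MBIEEB

/-- `β = (1 / (1 - γ)) √(ln (2 |S| |A| m / δ) / 2)`. -/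
def mbieBeta (nS nA m : ℕ) (δ γ : ℝ) : ℝ :=
  1 / (1 - γ) * Real.sqrt (Real.log (2 * nS * nA * m / δ) / 2)

/-- The logarithmic factor hidden in `Õ`; it is at least `1` for the parameters considered. -/
def logFactor (nS nA : ℕ) (ε δ γ : ℝ) : ℝ :=
  Real.log (Real.exp 1 * nS * nA / (ε * δ * (1 - γ)))

/-- A step in abstract state `x` with current abstract policy `π` is successful if `π` is
`ε`-optimal at `x` in the abstract MDP and the derived ground policy `π ∘ φ` is `ε'`-optimal in the
ground MDP at all ground states aggregated to `x`. -/
def SuccessfulStep {SG SA A : Type*} [Fintype SG] [Fintype SA] [Fintype A]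
    [DecidableEq SG] [DecidableEq SA] [DecidableEq A]
    (M : MDP SG A) (α : StateAbstraction SG SA) (ε ε' : ℝ) (π : SA → A) (x : SA) : Prop :=
  (M.abstract α).optValue x - (M.abstract α).value (detPolicy π) x ≤ ε ∧
    ∀ s, α.φ s = x → M.optValue s - M.value (detPolicy fun s => π (α.φ s)) s ≤ ε'

/-- `Q t` holds for all but at most `T` time steps `t`. -/
def AllButAtMost (T : ℝ) (Q : ℕ → Prop) : Prop :=
  {t | ¬ Q t}.Finite ∧ ({t | ¬ Q t}.ncard : ℝ) ≤ T

end

/-! The abstraction enters only at the end: the two suboptimality bounds and the triangle inequality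
turn `ε`-optimality in the abstract MDP into a ground loss of at most `g η + ε + g η ≤ 3 * g η`.
Everything else is a sample complexity bound for MBIE-EB on an arbitrary finite MDP
(`IsMBIEEBRun.measureReal_allButAtMost_ge`).

Put w = 1 - γ, H = 1 / w, and let V be the solution of the MBIE-EB equation. Three facts hold
simultaneously for all pairs and times with high probability: empirical means of V* are not too low,
they are not too high, and every transition frequency is at most (1 + w/2) times its probability
plus a term of order 1/n. The first makes V* a subsolution, so V ≥ V* (`IsBonusValue.optValue_le`).
Only this fact depends on the size of the actual bonus, and it produces the term with exponent p in
the failure probability; the others use free confidence widths and, together with the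
supermartingale event below, cost at most δ/4.

V depends on the data, so no Hoeffding bound applies to it directly. Split V = V* + (V - V*): the
first summand is a fixed function, the second is nonnegative, so the frequency bound controls its
empirical mean. Since γ(1 + w/2) ≤ 1 - w/2, the overestimation V - V^π contracts along the true
transitions up to an error that decays with the sample count (`overestimation_le`).

The potential is the excess (V - V^π - ε/2)⁺ at the current state. At the cap the contraction error
is absorbed by ε/2, and V and π change only when a sample is taken. Hence every error is charged to
a sample. An exponential supermartingale and Ville's inequality make the contraction pathwise, and
telescoping bounds the number of bad steps times εw/8 by the total charge
(`card_mul_le_of_potential`). That charge is, up to logarithms, |S||A|H times the cap, and the cap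
is of order max(p, 1)|S|H⁴/ε²; this gives the ε³ and (1 - γ)⁶ of the theorem. -/

noncomputable section

namespace MDP

/-! ### Horizon, policy values and Bellman equations. -/

section Basic

variable {S A : Type*} [Fintype S]

/-- The effective horizon `1 / (1 - γ)`, an upper bound for all policy values. -/
def horizon (M : MDP S A) : ℝ := 1 / (1 - M.γ)

lemma one_sub_γ_pos (M : MDP S A) : 0 < 1 - M.γ := sub_pos.2 M.γ_lt_one

lemma one_le_horizon (M : MDP S A) : 1 ≤ M.horizon := by
  have h := M.one_sub_γ_pos
  rw [horizon, le_div_iff₀ h]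
  linarith [M.γ_nonneg]

lemma horizon_pos (M : MDP S A) : 0 < M.horizon := zero_lt_one.trans_le M.one_le_horizon

lemma one_sub_γ_mul_horizon (M : MDP S A) : (1 - M.γ) * M.horizon = 1 :=
  mul_one_div_cancel M.one_sub_γ_pos.ne'

lemma one_add_γ_mul_horizon (M : MDP S A) : 1 + M.γ * M.horizon = M.horizon := by
  linarith [M.one_sub_γ_mul_horizon]

lemma sum_T_mul_le (M : MDP S A) (x : S) (u : A) {f : S → ℝ} {c : ℝ} (hf : ∀ y, f y ≤ c) :
    ∑ y, M.T x u y * f y ≤ c := by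
  calc ∑ y, M.T x u y * f y ≤ ∑ y, M.T x u y * c :=
        Finset.sum_le_sum fun y _ => mul_le_mul_of_nonneg_left (hf y) (M.T_nonneg x u y)
    _ = c := by rw [← Finset.sum_mul, M.T_sum, one_mul]

lemma sum_T_mul_nonneg (M : MDP S A) (x : S) (u : A) {f : S → ℝ} (hf : ∀ y, 0 ≤ f y) :
    0 ≤ ∑ y, M.T x u y * f y :=
  Finset.sum_nonneg fun y _ => mul_nonneg (M.T_nonneg x u y) (hf y)

end Basic

section Values

variable {S A : Type*} [Fintype S] [Fintype A] [DecidableEq A]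

lemma transMatrix_detPolicy (M : MDP S A) (π : S → A) (x y : S) :
    M.transMatrix (detPolicy π) x y = M.T x (π x) y := by
  simp [transMatrix, detPolicy, Pi.single_apply]

lemma policyReward_detPolicy (M : MDP S A) (π : S → A) (x : S) :
    M.policyReward (detPolicy π) x = M.R x (π x) := by
  simp [policyReward, detPolicy, Pi.single_apply]

lemma transMatrix_mulVec (M : MDP S A) (π : S → A) (f : S → ℝ) (x : S) :
    (M.transMatrix (detPolicy π)).mulVec f x = ∑ y, M.T x (π x) y * f y := by
  simp [Matrix.mulVec, dotProduct, transMatrix_detPolicy]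

variable [DecidableEq S]

lemma expectedReward_mem_Icc (M : MDP S A) (π : S → A) (t : ℕ) (x : S) :
    ((M.transMatrix (detPolicy π) ^ t).mulVec (M.policyReward (detPolicy π))) x ∈
      Set.Icc (0 : ℝ) 1 := by
  induction t generalizing x with
  | zero =>
    simp only [pow_zero, Matrix.one_mulVec, policyReward_detPolicy]
    exact ⟨M.R_nonneg _ _, M.R_le_one _ _⟩
  | succ t ih =>
    rw [pow_succ', ← Matrix.mulVec_mulVec, transMatrix_mulVec]
    exact ⟨M.sum_T_mul_nonneg _ _ fun y => (ih y).1, M.sum_T_mul_le _ _ fun y => (ih y).2⟩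

lemma summable_value (M : MDP S A) (π : S → A) (x : S) :
    Summable fun t : ℕ => M.γ ^ t *
      ((M.transMatrix (detPolicy π) ^ t).mulVec (M.policyReward (detPolicy π))) x := by
  refine Summable.of_nonneg_of_le (fun t => ?_) (fun t => ?_)
    (summable_geometric_of_lt_one M.γ_nonneg M.γ_lt_one)
  · exact mul_nonneg (pow_nonneg M.γ_nonneg t) (M.expectedReward_mem_Icc π t x).1
  · exact mul_le_of_le_one_right (pow_nonneg M.γ_nonneg t) (M.expectedReward_mem_Icc π t x).2

lemma value_nonneg (M : MDP S A) (π : S → A) (x : S) : 0 ≤ M.value (detPolicy π) x :=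
  tsum_nonneg fun t =>
    mul_nonneg (pow_nonneg M.γ_nonneg t) (M.expectedReward_mem_Icc π t x).1

lemma value_le_horizon (M : MDP S A) (π : S → A) (x : S) :
    M.value (detPolicy π) x ≤ M.horizon := by
  rw [horizon, one_div, ← tsum_geometric_of_lt_one M.γ_nonneg M.γ_lt_one]
  refine (M.summable_value π x).tsum_le_tsum (fun t => ?_)
    (summable_geometric_of_lt_one M.γ_nonneg M.γ_lt_one)
  exact mul_le_of_le_one_right (pow_nonneg M.γ_nonneg t) (M.expectedReward_mem_Icc π t x).2

/-- The Bellman equation of a deterministic policy. -/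
lemma value_eq (M : MDP S A) (π : S → A) (x : S) :
    M.value (detPolicy π) x =
      M.R x (π x) + M.γ * ∑ y, M.T x (π x) y * M.value (detPolicy π) y := by
  conv_lhs => rw [value, (M.summable_value π x).tsum_eq_zero_add]
  congr 1
  · simp [policyReward_detPolicy]
  · simp_rw [value, ← tsum_mul_left]
    rw [← Summable.tsum_finsetSum fun y _ => (M.summable_value π y).mul_left _, ← tsum_mul_left]
    refine tsum_congr fun t => ?_
    rw [pow_succ' (M.transMatrix _), ← Matrix.mulVec_mulVec, transMatrix_mulVec, pow_succ',
      mul_assoc, Finset.mul_sum]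
    congr 1
    exact Finset.sum_congr rfl fun y _ => by ring

lemma value_le_optValue (M : MDP S A) (π : S → A) (x : S) :
    M.value (detPolicy π) x ≤ M.optValue x :=
  le_ciSup (f := fun π : S → A => M.value (detPolicy π) x) (Set.finite_range _).bddAbove π

variable [Nonempty A]

lemma exists_value_eq_optValue (M : MDP S A) (x : S) :
    ∃ π : S → A, M.value (detPolicy π) x = M.optValue x :=
  exists_eq_ciSup_of_finite (f := fun π : S → A => M.value (detPolicy π) x)

lemma optValue_nonneg (M : MDP S A) (x : S) : 0 ≤ M.optValue x :=
  (M.value_nonneg (fun _ => Classical.arbitrary A) x).trans (M.value_le_optValue _ x)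

lemma optValue_le_horizon (M : MDP S A) (x : S) : M.optValue x ≤ M.horizon := by
  obtain ⟨π, h⟩ := M.exists_value_eq_optValue x
  exact h ▸ M.value_le_horizon π x

/-- The optimal value is attained by some action followed by optimal behaviour. -/
lemma exists_optValue_le (M : MDP S A) (x : S) :
    ∃ u, M.optValue x ≤ M.R x u + M.γ * ∑ y, M.T x u y * M.optValue y := by
  obtain ⟨π, h⟩ := M.exists_value_eq_optValue x
  refine ⟨π x, ?_⟩
  rw [← h, value_eq]
  gcongr with y
  · exact M.γ_nonneg
  · exact M.T_nonneg _ _ _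
  · exact M.value_le_optValue π y

end Values

end MDP

/-! ### Bookkeeping for visits and samples. -/

section Samples

variable {S A : Type*} [DecidableEq S] [DecidableEq A]

lemma visitCount_succ (s : ℕ → S) (a : ℕ → A) (t : ℕ) (x : S) (u : A) :
    visitCount s a (t + 1) x u = visitCount s a t x u + if s t = x ∧ a t = u then 1 else 0 := by
  unfold visitCount
  rw [Finset.range_add_one, Finset.filter_insert]
  split_ifs <;> simp

lemma sampleTimes_succ (c : ℕ) (s : ℕ → S) (a : ℕ → A) (t : ℕ) (x : S) (u : A) :
    sampleTimes c s a (t + 1) x u =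
      if (s t = x ∧ a t = u) ∧ visitCount s a t x u < c then insert t (sampleTimes c s a t x u)
      else sampleTimes c s a t x u := by
  unfold sampleTimes
  rw [Finset.range_add_one, Finset.filter_insert]

lemma notMem_sampleTimes (c : ℕ) (s : ℕ → S) (a : ℕ → A) (t : ℕ) (x : S) (u : A) :
    t ∉ sampleTimes c s a t x u := by
  simp [sampleTimes]

lemma sampleCount_succ (c : ℕ) (s : ℕ → S) (a : ℕ → A) (t : ℕ) (x : S) (u : A) :
    sampleCount c s a (t + 1) x u = sampleCount c s a t x u +
      if (s t = x ∧ a t = u) ∧ visitCount s a t x u < c then 1 else 0 := by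
  unfold sampleCount
  rw [sampleTimes_succ]
  split_ifs
  · rw [Finset.card_insert_of_notMem (notMem_sampleTimes c s a t x u)]
  · simp

lemma sampleCount_eq_min (c : ℕ) (s : ℕ → S) (a : ℕ → A) (t : ℕ) (x : S) (u : A) :
    sampleCount c s a t x u = min (visitCount s a t x u) c := by
  induction t with
  | zero => rfl
  | succ t ih =>
    rw [sampleCount_succ, visitCount_succ, ih]
    split_ifs <;> simp_all <;> omega

lemma sampleCount_le (c : ℕ) (s : ℕ → S) (a : ℕ → A) (t : ℕ) (x : S) (u : A) :
    sampleCount c s a t x u ≤ c := by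
  rw [sampleCount_eq_min]
  exact min_le_right _ _

lemma visitCount_lt_iff (c : ℕ) (s : ℕ → S) (a : ℕ → A) (t : ℕ) (x : S) (u : A) :
    visitCount s a t x u < c ↔ sampleCount c s a t x u < c := by
  rw [sampleCount_eq_min]
  omega

lemma sum_sampleTimes (c : ℕ) (s : ℕ → S) (a : ℕ → A) (t : ℕ) (x : S) (u : A) (F : ℕ → ℝ) :
    ∑ i ∈ sampleTimes c s a t x u, F i =
      ∑ i ∈ Finset.range t,
        if (s i = x ∧ a i = u) ∧ visitCount s a i x u < c then F i else 0 := by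
  rw [sampleTimes, Finset.sum_filter]

lemma visitCount_congr {s s' : ℕ → S} {a a' : ℕ → A} {t : ℕ} (hs : ∀ i < t, s i = s' i)
    (ha : ∀ i < t, a i = a' i) (x : S) (u : A) :
    visitCount s a t x u = visitCount s' a' t x u := by
  unfold visitCount
  congr 1
  refine Finset.filter_congr fun i hi => ?_
  rw [hs i (Finset.mem_range.1 hi), ha i (Finset.mem_range.1 hi)]

lemma sampleTimes_congr {s s' : ℕ → S} {a a' : ℕ → A} {t : ℕ} (hs : ∀ i < t, s i = s' i)
    (ha : ∀ i < t, a i = a' i) (c : ℕ) (x : S) (u : A) :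
    sampleTimes c s a t x u = sampleTimes c s' a' t x u := by
  unfold sampleTimes
  refine Finset.filter_congr fun i hi => ?_
  have hi := Finset.mem_range.1 hi
  rw [hs i hi, ha i hi, visitCount_congr (fun j hj => hs j (hj.trans hi))
    (fun j hj => ha j (hj.trans hi))]

lemma sampleCount_congr {s s' : ℕ → S} {a a' : ℕ → A} {t : ℕ} (hs : ∀ i < t, s i = s' i)
    (ha : ∀ i < t, a i = a' i) (c : ℕ) (x : S) (u : A) :
    sampleCount c s a t x u = sampleCount c s' a' t x u := by
  unfold sampleCount
  rw [sampleTimes_congr hs ha]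

lemma sum_sampleTimes_div_le {c : ℕ} {s : ℕ → S} {a : ℕ → A} {t : ℕ} {x : S} {u : A}
    (h : sampleCount c s a t x u ≠ 0) {f : S → ℝ} {κ : ℝ} (hf : ∀ y, f y ≤ κ) :
    (∑ i ∈ sampleTimes c s a t x u, f (s (i + 1))) / sampleCount c s a t x u ≤ κ := by
  have h' : (0 : ℝ) < sampleCount c s a t x u := Nat.cast_pos.2 (Nat.pos_of_ne_zero h)
  rw [div_le_iff₀ h', mul_comm, sampleCount, ← nsmul_eq_mul]
  exact Finset.sum_le_card_nsmul _ _ _ fun i _ => hf _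

end Samples

/-! ### The MBIE-EB equation: comparison, uniqueness, stability. -/

section BonusEquation

variable {S A : Type*} [Fintype S] [DecidableEq S] [DecidableEq A]

/-- Grouping the samples by their successor state. The form with a sum over samples is the one to
which martingale bounds apply. -/
lemma sum_empTrans_mul (c : ℕ) (s : ℕ → S) (a : ℕ → A) (t : ℕ) (x : S) (u : A) (f : S → ℝ) :
    ∑ y, empTrans c s a t x u y * f y =
      (∑ i ∈ sampleTimes c s a t x u, f (s (i + 1))) / sampleCount c s a t x u := by
  simp_rw [empTrans, div_mul_eq_mul_div, ← Finset.sum_div]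
  congr 1
  rw [← Finset.sum_fiberwise _ (fun i => s (i + 1))]
  refine Finset.sum_congr rfl fun y _ => ?_
  rw [Finset.sum_congr rfl (g := fun _ => f y), Finset.sum_const, nsmul_eq_mul]
  intro i hi
  rw [(Finset.mem_filter.1 hi).2]

/-- Rewards are deterministic, so only the transitions need concentration bounds. -/
lemma empReward_eq (M : MDP S A) {c : ℕ} {s : ℕ → S} {a : ℕ → A} {t : ℕ} {x : S} {u : A}
    (h : sampleCount c s a t x u ≠ 0) : empReward M c s a t x u = M.R x u := by
  have h' : (sampleCount c s a t x u : ℝ) ≠ 0 := Nat.cast_ne_zero.2 h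
  rw [empReward, div_eq_iff h', Finset.sum_congr rfl (g := fun _ => M.R x u), Finset.sum_const,
    nsmul_eq_mul, sampleCount, mul_comm]
  intro i hi
  obtain ⟨_, ⟨rfl, rfl⟩, _⟩ := Finset.mem_filter.1 hi
  rfl

lemma bonusBackup_of_eq_zero (M : MDP S A) (b : ℝ) {c : ℕ} {s : ℕ → S} {a : ℕ → A} {t : ℕ}
    {x : S} {u : A} (h : sampleCount c s a t x u = 0) (V : S → ℝ) :
    bonusBackup M b c s a t V x u = M.horizon := by
  rw [bonusBackup, if_pos h, MDP.horizon]

lemma bonusBackup_of_ne_zero (M : MDP S A) (b : ℝ) {c : ℕ} {s : ℕ → S} {a : ℕ → A} {t : ℕ}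
    {x : S} {u : A} (h : sampleCount c s a t x u ≠ 0) (V : S → ℝ) :
    bonusBackup M b c s a t V x u = M.R x u +
      M.γ * ((∑ i ∈ sampleTimes c s a t x u, V (s (i + 1))) / sampleCount c s a t x u) +
      b / Real.sqrt (sampleCount c s a t x u) := by
  rw [bonusBackup, if_neg h, empReward_eq M h, sum_empTrans_mul]

/-- Reward and bonus cancel, leaving γ times an empirical mean. This one-sided contraction drives
both comparison principles below. -/
lemma bonusBackup_sub_le (M : MDP S A) (b : ℝ) (c : ℕ) (s : ℕ → S) (a : ℕ → A) (t : ℕ)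
    (x : S) (u : A) {V V' : S → ℝ} {κ : ℝ} (hκ : 0 ≤ κ) (h : ∀ y, V' y - V y ≤ κ) :
    bonusBackup M b c s a t V' x u - bonusBackup M b c s a t V x u ≤ M.γ * κ := by
  by_cases hn : sampleCount c s a t x u = 0
  · rw [bonusBackup_of_eq_zero M b hn, bonusBackup_of_eq_zero M b hn, sub_self]
    exact mul_nonneg M.γ_nonneg hκ
  · rw [bonusBackup_of_ne_zero M b hn, bonusBackup_of_ne_zero M b hn]
    have := mul_le_mul_of_nonneg_left
      (sum_sampleTimes_div_le (f := fun y => V' y - V y) hn h) M.γ_nonneg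
    rw [Finset.sum_sub_distrib, sub_div] at this
    linarith

section Solutions

variable [Finite A] {M : MDP S A} {b : ℝ} {c : ℕ} {s : ℕ → S} {a : ℕ → A} {t : ℕ} {V : S → ℝ}

lemma IsBonusValue.backup_le (hV : IsBonusValue M b c s a t V) (x : S) (u : A) :
    bonusBackup M b c s a t V x u ≤ V x := by
  rw [hV x]
  exact le_ciSup (Set.finite_range _).bddAbove u

/-- Comparison of a solution of the MBIE-EB equation with an approximate subsolution. -/
lemma IsBonusValue.le_add_of_subsolution (hV : IsBonusValue M b c s a t V) {V' : S → ℝ} {κ : ℝ}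
    (hκ : 0 ≤ κ) (h : ∀ x, ∃ u, V' x ≤ bonusBackup M b c s a t V' x u + κ) (x : S) :
    V' x ≤ V x + M.horizon * κ := by
  have : Nonempty S := ⟨x⟩
  obtain ⟨x₀, hx₀⟩ := Finite.exists_max fun x => V' x - V x
  have hH := M.one_sub_γ_mul_horizon
  have hpos := M.one_sub_γ_pos
  -- Maximum principle: the largest gap z satisfies z ≤ γ z + κ, hence z ≤ H κ.
  suffices V' x₀ - V x₀ ≤ M.horizon * κ by linarith [hx₀ x]
  by_contra! hlt
  have h0 : 0 ≤ V' x₀ - V x₀ := (mul_nonneg M.horizon_pos.le hκ).trans hlt.le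
  obtain ⟨u, hu⟩ := h x₀
  have h1 := bonusBackup_sub_le M b c s a t x₀ u h0 hx₀
  have h2 := hV.backup_le x₀ u
  nlinarith

lemma IsBonusValue.le_of_supersolution [Nonempty A] (hV : IsBonusValue M b c s a t V)
    {V' : S → ℝ} (h : ∀ x u, bonusBackup M b c s a t V' x u ≤ V' x) (x : S) : V x ≤ V' x := by
  have : Nonempty S := ⟨x⟩
  obtain ⟨x₀, hx₀⟩ := Finite.exists_max fun x => V x - V' x
  have hpos := M.one_sub_γ_pos
  suffices V x₀ - V' x₀ ≤ 0 by linarith [hx₀ x]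
  by_contra! hlt
  obtain ⟨u, hu⟩ := exists_eq_ciSup_of_finite (f := fun u => bonusBackup M b c s a t V x₀ u)
  rw [← hV x₀] at hu
  have h1 := bonusBackup_sub_le M b c s a t x₀ u hlt.le hx₀
  have h2 := h x₀ u
  nlinarith

variable [Nonempty A]

lemma IsBonusValue.exists_eq (hV : IsBonusValue M b c s a t V) (x : S) :
    ∃ u, V x = bonusBackup M b c s a t V x u := by
  obtain ⟨u, hu⟩ := exists_eq_ciSup_of_finite (f := fun u => bonusBackup M b c s a t V x u)
  exact ⟨u, by rw [hu, ← hV x]⟩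

/-- Uniqueness is what later makes a solution picked by choice, outcome by outcome, a function of
the observed data. -/
lemma IsBonusValue.unique (hV : IsBonusValue M b c s a t V) {V' : S → ℝ}
    (hV' : IsBonusValue M b c s a t V') : V = V' :=
  funext fun x => le_antisymm (hV.le_of_supersolution hV'.backup_le x)
    (hV'.le_of_supersolution hV.backup_le x)

lemma IsBonusValue.nonneg (hV : IsBonusValue M b c s a t V) (hb : 0 ≤ b) (x : S) : 0 ≤ V x := by
  have := hV.le_add_of_subsolution (V' := fun _ => 0) le_rfl (fun x => ?_) x
  · simpa using this
  · refine ⟨Classical.arbitrary A, ?_⟩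
    by_cases hn : sampleCount c s a t x (Classical.arbitrary A) = 0
    · rw [bonusBackup_of_eq_zero M b hn]
      simpa using M.horizon_pos.le
    · rw [bonusBackup_of_ne_zero M b hn]
      have h1 := M.R_nonneg x (Classical.arbitrary A)
      have h2 : 0 ≤ b / Real.sqrt (sampleCount c s a t x (Classical.arbitrary A)) := by positivity
      simp only [Finset.sum_const_zero, zero_div, mul_zero, add_zero]
      linarith

lemma IsBonusValue.le (hV : IsBonusValue M b c s a t V) (hb : 0 ≤ b) (x : S) :
    V x ≤ M.horizon * (1 + b) := by
  -- The constant H(1 + b) solves v = 1 + b + γ v, the equation with maximal reward and maximal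
  -- bonus.
  refine hV.le_of_supersolution (V' := fun _ => M.horizon * (1 + b)) (fun x u => ?_) x
  have hH := M.one_le_horizon
  by_cases hn : sampleCount c s a t x u = 0
  · rw [bonusBackup_of_eq_zero M b hn]
    nlinarith
  · rw [bonusBackup_of_ne_zero M b hn]
    have h1 := M.R_le_one x u
    have h2 := mul_le_mul_of_nonneg_left (sum_sampleTimes_div_le hn
      (f := fun _ => M.horizon * (1 + b)) fun _ => le_rfl) M.γ_nonneg
    have h3 : b / Real.sqrt (sampleCount c s a t x u) ≤ b := by
      refine div_le_self hb (Real.one_le_sqrt.2 ?_)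
      exact_mod_cast Nat.one_le_iff_ne_zero.2 hn
    have h4 := M.one_add_γ_mul_horizon
    have h5 : M.γ * (M.horizon * (1 + b)) = (M.horizon - 1) * (1 + b) := by
      linear_combination (1 + b) * h4
    linarith

end Solutions

lemma bonusBackup_congr (M : MDP S A) (b : ℝ) (c : ℕ) {s s' : ℕ → S} {a a' : ℕ → A} {t : ℕ}
    (hs : ∀ i ≤ t, s i = s' i) (ha : ∀ i < t, a i = a' i) (V : S → ℝ) (x : S) (u : A) :
    bonusBackup M b c s a t V x u = bonusBackup M b c s' a' t V x u := by
  have hs' : ∀ i < t, s i = s' i := fun i hi => hs i hi.le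
  by_cases hn : sampleCount c s a t x u = 0
  · rw [bonusBackup_of_eq_zero M b hn, bonusBackup_of_eq_zero M b]
    rwa [← sampleCount_congr hs' ha]
  · rw [bonusBackup_of_ne_zero M b hn, bonusBackup_of_ne_zero M b,
      sampleCount_congr hs' ha, sampleTimes_congr hs' ha]
    · congr 4
      refine Finset.sum_congr rfl fun i hi => ?_
      rw [hs (i + 1) (Finset.mem_range.1 (Finset.mem_filter.1 hi).1)]
    · rwa [← sampleCount_congr hs' ha]

lemma bonusBackup_succ_of_not_sampled (M : MDP S A) (b : ℝ) {c : ℕ} {s : ℕ → S} {a : ℕ → A}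
    {t : ℕ} {x : S} {u : A} (h : ¬ ((s t = x ∧ a t = u) ∧ visitCount s a t x u < c))
    (V : S → ℝ) :
    bonusBackup M b c s a (t + 1) V x u = bonusBackup M b c s a t V x u := by
  have h1 : sampleTimes c s a (t + 1) x u = sampleTimes c s a t x u := by
    rw [sampleTimes_succ, if_neg h]
  have h2 : sampleCount c s a (t + 1) x u = sampleCount c s a t x u := by
    rw [sampleCount, h1, sampleCount]
  by_cases hn : sampleCount c s a t x u = 0
  · rw [bonusBackup_of_eq_zero M b hn, bonusBackup_of_eq_zero M b (h2.trans hn)]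
  · rw [bonusBackup_of_ne_zero M b hn, bonusBackup_of_ne_zero M b (h2 ▸ hn), h1, h2]

/-- One more sample of a pair that has been tried decreases its backup only slightly. -/
lemma bonusBackup_le_succ_add (M : MDP S A) {b : ℝ} (hb : 0 ≤ b) {c : ℕ} {s : ℕ → S}
    {a : ℕ → A} {t : ℕ} {V : S → ℝ} {Vm : ℝ} (hV0 : ∀ x, 0 ≤ V x) (hV : ∀ x, V x ≤ Vm)
    (hn : sampleCount c s a t (s t) (a t) ≠ 0) (x : S) (u : A) :
    bonusBackup M b c s a t V x u ≤ bonusBackup M b c s a (t + 1) V x u +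
      (Vm + b) / sampleCount c s a t (s t) (a t) := by
  have hVm : 0 ≤ Vm := (hV0 (s t)).trans (hV (s t))
  by_cases h : (s t = x ∧ a t = u) ∧ visitCount s a t x u < c
  · obtain ⟨⟨rfl, rfl⟩, hc⟩ := h
    have hs : sampleCount c s a (t + 1) (s t) (a t) = sampleCount c s a t (s t) (a t) + 1 := by
      rw [sampleCount_succ, if_pos ⟨⟨rfl, rfl⟩, hc⟩]
    have ht : sampleTimes c s a (t + 1) (s t) (a t) =
        insert t (sampleTimes c s a t (s t) (a t)) := by
      rw [sampleTimes_succ, if_pos ⟨⟨rfl, rfl⟩, hc⟩]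
    have hmean := sum_sampleTimes_div_le hn hV
    rw [bonusBackup_of_ne_zero M b hn, bonusBackup_of_ne_zero M b (by omega), hs, ht,
      Finset.sum_insert (notMem_sampleTimes c s a t _ _)]
    set n := sampleCount c s a t (s t) (a t)
    set W := ∑ i ∈ sampleTimes c s a t (s t) (a t), V (s (i + 1))
    have hn0 : (1 : ℝ) ≤ n := by exact_mod_cast Nat.one_le_iff_ne_zero.2 hn
    push_cast
    have h1 : W / n - (V (s (t + 1)) + W) / (n + 1) ≤ Vm / n := by
      -- A new value moves a mean of n numbers by (mean - value) / (n + 1). The resulting order 1/n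
      -- matters: summed over the samples it costs only a logarithm.
      have : W / n - (V (s (t + 1)) + W) / (n + 1) = (W / n - V (s (t + 1))) / (n + 1) := by
        field_simp
        ring
      rw [this]
      refine div_le_div₀ hVm ?_ (by linarith) (by linarith)
      exact (sub_le_self _ (hV0 (s (t + 1)))).trans hmean
    have h2 : M.γ * (W / n - (V (s (t + 1)) + W) / (n + 1)) ≤ Vm / n := by
      have h0 : 0 ≤ Vm / n := by positivity
      nlinarith [M.γ_nonneg, M.γ_lt_one]
    -- A crude bound, using only √(n+1) - √n ≤ 1; order 1/n is all that is needed.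
    have h3 : b / Real.sqrt n - b / Real.sqrt (n + 1) ≤ b / n := by
      have e1 : 1 ≤ Real.sqrt n := Real.one_le_sqrt.2 hn0
      have e2 : Real.sqrt n ≤ Real.sqrt (n + 1) := Real.sqrt_le_sqrt (by linarith)
      have e3 : Real.sqrt n ^ 2 = n := Real.sq_sqrt (by linarith)
      have e4 : Real.sqrt ((n : ℝ) + 1) ≤ Real.sqrt n + 1 := by
        rw [Real.sqrt_le_left (by linarith)]
        nlinarith
      have : b / Real.sqrt n - b / Real.sqrt (n + 1) =
          b * (Real.sqrt (n + 1) - Real.sqrt n) / (Real.sqrt n * Real.sqrt (n + 1)) := by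
        field_simp
      rw [this]
      refine div_le_div₀ hb ?_ (by linarith) ?_
      · nlinarith
      · nlinarith
    rw [add_div Vm b]
    linarith
  · rw [bonusBackup_succ_of_not_sampled M b h]
    exact le_add_of_nonneg_right (by positivity)

end BonusEquation

/-! ### Ville's inequality on a finite state tree. -/

section Ville

open MeasureTheory

variable {Ω S : Type*}

/-- The outcomes that share the first `k + 1` states with `ω`. -/
def historyCylinder (s : ℕ → Ω → S) (k : ℕ) (ω : Ω) : Set Ω :=
  {ω' | ∀ i ≤ k, s i ω' = s i ω}

lemma sum_increment_eq {s : ℕ → Ω → S} {ξ : ℕ → Ω → S → ℝ}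
    (hξ : ∀ k ω, ∀ ω' ∈ historyCylinder s k ω, ξ k ω' = ξ k ω)
    {k : ℕ} {ω ω' : Ω} (h : ω' ∈ historyCylinder s k ω) :
    ∑ i ∈ Finset.range k, ξ i ω' (s (i + 1) ω') = ∑ i ∈ Finset.range k, ξ i ω (s (i + 1) ω) := by
  refine Finset.sum_congr rfl fun i hi => ?_
  have hi := Finset.mem_range.1 hi
  rw [hξ i ω ω' fun j hj => h j (by omega), h (i + 1) hi]

variable [MeasurableSpace Ω] [Fintype S] {P : Measure Ω} [IsProbabilityMeasure P]
  {s : ℕ → Ω → S} {q : ℕ → Ω → S → ℝ} {ξ : ℕ → Ω → S → ℝ}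

/-- Induction on the number `j` of remaining steps, over all histories. If the level is already
reached, the exponential on the right is at least 1; otherwise the event splits according to the
next state and `hexp` says that the exponential does not grow on average. Cylinders take the place
of conditional expectations. -/
lemma measureReal_cylinder_inter_exists_le
    (hq : ∀ k ω y, 0 ≤ q k ω y)
    (hlaw : ∀ k ω y, P.real (historyCylinder s k ω ∩ {ω' | s (k + 1) ω' = y}) =
      P.real (historyCylinder s k ω) * q k ω y)
    (hξ : ∀ k ω, ∀ ω' ∈ historyCylinder s k ω, ξ k ω' = ξ k ω)
    (hexp : ∀ k ω, ∑ y, q k ω y * Real.exp (ξ k ω y) ≤ 1) (c : ℝ) (j k : ℕ) (ω : Ω) :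
    P.real (historyCylinder s k ω ∩ {ω' | ∃ t, k ≤ t ∧ t ≤ k + j ∧
      c ≤ ∑ i ∈ Finset.range t, ξ i ω' (s (i + 1) ω')}) ≤
    P.real (historyCylinder s k ω) *
      Real.exp (∑ i ∈ Finset.range k, ξ i ω (s (i + 1) ω) - c) := by
  classical
  induction j generalizing k ω with
  | zero =>
    by_cases h : c ≤ ∑ i ∈ Finset.range k, ξ i ω (s (i + 1) ω)
    · refine (measureReal_mono Set.inter_subset_left).trans ?_
      exact le_mul_of_one_le_right measureReal_nonneg (Real.one_le_exp (sub_nonneg.2 h))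
    · have : historyCylinder s k ω ∩ {ω' | ∃ t, k ≤ t ∧ t ≤ k + 0 ∧
          c ≤ ∑ i ∈ Finset.range t, ξ i ω' (s (i + 1) ω')} = ∅ := by
        refine Set.eq_empty_of_forall_notMem ?_
        rintro ω' ⟨hω', t, h1, h2, h3⟩
        obtain rfl : t = k := by omega
        rw [sum_increment_eq hξ hω'] at h3
        exact h h3
      rw [this, measureReal_empty]
      positivity
  | succ j ih =>
    by_cases h : c ≤ ∑ i ∈ Finset.range k, ξ i ω (s (i + 1) ω)
    · refine (measureReal_mono Set.inter_subset_left).trans ?_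
      exact le_mul_of_one_le_right measureReal_nonneg (Real.one_le_exp (sub_nonneg.2 h))
    have hsub : historyCylinder s k ω ∩ {ω' | ∃ t, k ≤ t ∧ t ≤ k + (j + 1) ∧
          c ≤ ∑ i ∈ Finset.range t, ξ i ω' (s (i + 1) ω')} ⊆
        ⋃ y, (historyCylinder s k ω ∩ {ω' | s (k + 1) ω' = y}) ∩
          {ω' | ∃ t, k + 1 ≤ t ∧ t ≤ k + 1 + j ∧
            c ≤ ∑ i ∈ Finset.range t, ξ i ω' (s (i + 1) ω')} := by
      rintro ω' ⟨hω', t, h1, h2, h3⟩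
      refine Set.mem_iUnion.2 ⟨s (k + 1) ω', ⟨hω', rfl⟩, t, ?_, by omega, h3⟩
      rcases h1.eq_or_lt with rfl | h1
      · rw [sum_increment_eq hξ hω'] at h3
        exact absurd h3 h
      · exact h1
    refine (measureReal_mono hsub).trans ((measureReal_iUnion_fintype_le _).trans ?_)
    calc _ ≤ ∑ y, P.real (historyCylinder s k ω) *
          Real.exp (∑ i ∈ Finset.range k, ξ i ω (s (i + 1) ω) - c) *
            (q k ω y * Real.exp (ξ k ω y)) := by
          refine Finset.sum_le_sum fun y _ => ?_
          by_cases hy : ∃ ω₁ ∈ historyCylinder s k ω, s (k + 1) ω₁ = y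
          · obtain ⟨ω₁, hω₁, rfl⟩ := hy
            have hcyl : historyCylinder s k ω ∩ {ω' | s (k + 1) ω' = s (k + 1) ω₁} =
                historyCylinder s (k + 1) ω₁ := by
              ext ω'
              constructor
              · rintro ⟨h1, h2⟩ i hi
                rcases Nat.le_succ_iff.1 hi with hi | rfl
                · rw [h1 i hi, hω₁ i hi]
                · exact h2
              · intro h1
                refine ⟨fun i hi => ?_, h1 (k + 1) le_rfl⟩
                rw [h1 i (by omega), hω₁ i hi]
            have := ih (k + 1) ω₁
            rw [← hcyl, hlaw, Finset.sum_range_succ, sum_increment_eq hξ hω₁, hξ k ω ω₁ hω₁] at this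
            refine this.trans (le_of_eq ?_)
            rw [add_sub_right_comm, Real.exp_add]
            ring
          · rw [Set.eq_empty_of_forall_notMem (s := _ ∩ _), measureReal_empty]
            · have := hq k ω y
              positivity
            · rintro ω' ⟨⟨h1, h2⟩, -⟩
              exact hy ⟨ω', h1, h2⟩
      _ ≤ _ := by
          rw [← Finset.mul_sum]
          exact mul_le_of_le_one_right (by positivity) (hexp k ω)

/-- **Ville's inequality** for the exponential supermartingale with increments
`ξ k ω (s (k + 1) ω)`, where `q k ω` is the law of `s (k + 1)` given the history. -/
theorem measureReal_exists_le_sum_le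
    (hmeas : ∀ y, MeasurableSet {ω | s 0 ω = y})
    (hq : ∀ k ω y, 0 ≤ q k ω y)
    (hlaw : ∀ k ω y, P.real (historyCylinder s k ω ∩ {ω' | s (k + 1) ω' = y}) =
      P.real (historyCylinder s k ω) * q k ω y)
    (hξ : ∀ k ω, ∀ ω' ∈ historyCylinder s k ω, ξ k ω' = ξ k ω)
    (hexp : ∀ k ω, ∑ y, q k ω y * Real.exp (ξ k ω y) ≤ 1) (c : ℝ) :
    P.real {ω | ∃ t, c ≤ ∑ i ∈ Finset.range t, ξ i ω (s (i + 1) ω)} ≤ Real.exp (-c) := by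
  classical
  set E : ℕ → Set Ω := fun j => {ω | ∃ t ≤ j, c ≤ ∑ i ∈ Finset.range t, ξ i ω (s (i + 1) ω)}
  have hE : ∀ j, P.real (E j) ≤ Real.exp (-c) := by
    intro j
    have hsub : E j ⊆ ⋃ y, {ω | s 0 ω = y} ∩ E j := fun ω hω =>
      Set.mem_iUnion.2 ⟨s 0 ω, rfl, hω⟩
    refine (measureReal_mono hsub).trans ((measureReal_iUnion_fintype_le _).trans ?_)
    calc _ ≤ ∑ y, P.real {ω | s 0 ω = y} * Real.exp (-c) := by
          refine Finset.sum_le_sum fun y _ => ?_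
          by_cases hy : ∃ ω₁, s 0 ω₁ = y
          · obtain ⟨ω₁, rfl⟩ := hy
            have := measureReal_cylinder_inter_exists_le hq hlaw hξ hexp c j 0 ω₁
            simpa [historyCylinder, E] using this
          · rw [Set.eq_empty_of_forall_notMem (s := _ ∩ _), measureReal_empty]
            · positivity
            · rintro ω' ⟨h1, -⟩
              exact hy ⟨ω', h1⟩
      _ = Real.exp (-c) := by
          have h1 : ∑ y, P.real {ω | s 0 ω = y} = P.real (⋃ y, {ω | s 0 ω = y}) := by
            rw [measureReal_iUnion_fintype _ hmeas]
            intro y y' hne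
            refine Set.disjoint_left.2 fun ω h h' => hne ?_
            rw [← (h : s 0 ω = y), ← (h' : s 0 ω = y')]
          have h2 : (⋃ y, {ω | s 0 ω = y}) = Set.univ :=
            Set.eq_univ_of_forall fun ω => Set.mem_iUnion.2 ⟨s 0 ω, rfl⟩
          rw [← Finset.sum_mul, h1, h2, probReal_univ, one_mul]
  have hU : {ω | ∃ t, c ≤ ∑ i ∈ Finset.range t, ξ i ω (s (i + 1) ω)} = ⋃ j, E j := by
    ext ω
    simp only [Set.mem_iUnion, Set.mem_ofPred_eq, E]
    exact ⟨fun ⟨t, h⟩ => ⟨t, t, le_rfl, h⟩, fun ⟨_, t, _, h⟩ => ⟨t, h⟩⟩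
  have hmono : Monotone E := by
    rintro i j hij ω ⟨t, ht, h⟩
    exact ⟨t, ht.trans hij, h⟩
  -- Continuity from below along a monotone union; no measurability of the events is required.
  rw [hU, measureReal_def, hmono.measure_iUnion]
  refine ENNReal.toReal_le_of_le_ofReal (Real.exp_pos _).le (iSup_le fun j => ?_)
  rw [← ENNReal.ofReal_toReal (measure_ne_top P (E j))]
  exact ENNReal.ofReal_le_ofReal (hE j)

end Ville

/-! ### Exponential moments for finitely supported laws. -/

section FiniteMGF

/-- Hoeffding's lemma for a finitely supported distribution. -/
lemma sum_mul_exp_sub_le {S : Type*} [Fintype S] {q f : S → ℝ} {c : ℝ} (hq : ∀ y, 0 ≤ q y)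
    (hq1 : ∑ y, q y = 1) (hf0 : ∀ y, 0 ≤ f y) (hfc : ∀ y, f y ≤ c) (l : ℝ) :
    ∑ y, q y * Real.exp (l * (f y - ∑ z, q z * f z)) ≤ Real.exp (l ^ 2 * c ^ 2 / 8) := by
  let _ : MeasurableSpace S := ⊤
  have : MeasurableSingletonClass S := ⟨fun _ => trivial⟩
  have hsum : ∑ y, ENNReal.ofReal (q y) = 1 := by
    rw [← ENNReal.ofReal_sum_of_nonneg fun y _ => hq y, hq1, ENNReal.ofReal_one]
  have hint : ∀ g : S → ℝ, ∫ y, g y ∂(PMF.ofFintype _ hsum).toMeasure = ∑ y, q y * g y := by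
    intro g
    rw [PMF.integral_eq_sum]
    simp [ENNReal.toReal_ofReal (hq _)]
  have h := (ProbabilityTheory.hasSubgaussianMGF_of_mem_Icc (a := 0) (b := c)
    (μ := (PMF.ofFintype _ hsum).toMeasure) (X := f) (measurable_of_finite f).aemeasurable
    (Filter.Eventually.of_forall fun y => ⟨hf0 y, hfc y⟩)).mgf_le l
  rw [ProbabilityTheory.mgf, hint, hint] at h
  refine h.trans (le_of_eq ?_)
  congr 1
  have : ((‖c - 0‖₊ / 2) ^ 2 : NNReal) = c ^ 2 / 4 := by
    push_cast
    rw [sub_zero, Real.norm_eq_abs, div_pow, sq_abs]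
    norm_num
  rw [this]
  ring

/-- The exponential moment of an indicator, in multiplicative form. -/
lemma sum_mul_exp_indicator_le {S : Type*} [Fintype S] [DecidableEq S] {q : S → ℝ}
    (hq : ∀ y, 0 ≤ q y) (hq1 : ∑ y, q y = 1) {θ : ℝ} (hθ0 : 0 ≤ θ) (hθ1 : θ ≤ 1) (z : S) :
    ∑ y, q y * Real.exp (θ * (if y = z then 1 else 0) - θ * ((1 + θ) * q z)) ≤ 1 := by
  have h1 : ∀ y, q y * Real.exp (θ * (if y = z then 1 else 0) - θ * ((1 + θ) * q z)) =
      Real.exp (-(θ * ((1 + θ) * q z))) * (q y + if y = z then q y * (Real.exp θ - 1) else 0) := by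
    intro y
    rw [sub_eq_add_neg, Real.exp_add]
    split_ifs <;> simp <;> ring
  simp_rw [h1]
  rw [← Finset.mul_sum, Finset.sum_add_distrib, hq1, Finset.sum_ite_eq' Finset.univ z]
  simp only [Finset.mem_univ, if_true]
  -- From the second-order Taylor bound for exp on [0, 1]; this is where the factor 1 + θ
  -- originates.
  have h2 : Real.exp θ - 1 ≤ θ * (1 + θ) := by
    have := Real.abs_exp_sub_one_sub_id_le (x := θ) (by rwa [abs_of_nonneg hθ0])
    nlinarith [(abs_le.1 this).2]
  have h3 : 1 + q z * (Real.exp θ - 1) ≤ Real.exp (θ * ((1 + θ) * q z)) := by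
    have := Real.add_one_le_exp (θ * ((1 + θ) * q z))
    nlinarith [mul_le_mul_of_nonneg_left h2 (hq z)]
  calc _ ≤ Real.exp (-(θ * ((1 + θ) * q z))) * Real.exp (θ * ((1 + θ) * q z)) := by gcongr
    _ = 1 := by rw [← Real.exp_add, neg_add_cancel, Real.exp_zero]

end FiniteMGF

/-! ### Concentration along a run. -/

section Run

open MeasureTheory

variable {S A Ω : Type*} [Fintype S] [DecidableEq S] [DecidableEq A]
  [MeasurableSpace Ω] {P : Measure Ω} {M : MDP S A} {b : ℝ} {c : ℕ} {tie : S → (A → ℝ) → A}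
  {s : ℕ → Ω → S} {a : ℕ → Ω → A} {π : ℕ → Ω → S → A}

/-- The solution of the MBIE-EB equation at time `t`. -/
def IsMBIEEBRun.bonusValue (h : IsMBIEEBRun P M b c tie s a π) (t : ℕ) (ω : Ω) : S → ℝ :=
  (h.policy t ω).choose

lemma IsMBIEEBRun.isBonusValue (h : IsMBIEEBRun P M b c tie s a π) (t : ℕ) (ω : Ω) :
    IsBonusValue M b c (fun i => s i ω) (fun i => a i ω) t (h.bonusValue t ω) :=
  (h.policy t ω).choose_spec.1

lemma IsMBIEEBRun.policy_eq (h : IsMBIEEBRun P M b c tie s a π) (t : ℕ) (ω : Ω) (x : S) :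
    π t ω x = tie x
      (bonusBackup M b c (fun i => s i ω) (fun i => a i ω) t (h.bonusValue t ω) x) :=
  (h.policy t ω).choose_spec.2 x

variable [Fintype A] [Nonempty A]

lemma IsMBIEEBRun.bonusValue_eq (h : IsMBIEEBRun P M b c tie s a π) (htie : IsGreedyRule tie)
    (t : ℕ) (ω : Ω) (x : S) :
    h.bonusValue t ω x =
      bonusBackup M b c (fun i => s i ω) (fun i => a i ω) t (h.bonusValue t ω) x (π t ω x) := by
  refine le_antisymm ?_ ((h.isBonusValue t ω).backup_le x _)
  rw [h.policy_eq, h.isBonusValue t ω x]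
  exact ciSup_le fun u => htie x _ u

/-- Used in two ways: for two outcomes with the same history, where it shows that the algorithm is
adapted, and for two consecutive times without a new sample, where it shows that the policy is
frozen. The fixed tie-breaking rule is essential for both. -/
lemma IsMBIEEBRun.eq_of_backup_eq (h : IsMBIEEBRun P M b c tie s a π) {t t' : ℕ} {ω ω' : Ω}
    (heq : ∀ V x u, bonusBackup M b c (fun i => s i ω') (fun i => a i ω') t' V x u =
      bonusBackup M b c (fun i => s i ω) (fun i => a i ω) t V x u) :
    h.bonusValue t' ω' = h.bonusValue t ω ∧ π t' ω' = π t ω := by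
  have h1 : h.bonusValue t' ω' = h.bonusValue t ω := by
    refine IsBonusValue.unique (h.isBonusValue t' ω') fun x => ?_
    rw [h.isBonusValue t ω x]
    simp_rw [heq]
  refine ⟨h1, funext fun x => ?_⟩
  rw [h.policy_eq, h.policy_eq, h1]
  congr 1
  exact funext fun u => heq _ x u

/-- The algorithm is determined by the history of states. -/
lemma IsMBIEEBRun.eq_of_mem_cylinder (h : IsMBIEEBRun P M b c tie s a π) (k : ℕ) {ω ω' : Ω}
    (hω : ω' ∈ historyCylinder s k ω) :
    a k ω' = a k ω ∧ h.bonusValue k ω' = h.bonusValue k ω ∧ π k ω' = π k ω := by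
  induction k using Nat.strong_induction_on with
  | _ k ih =>
    have h1 := h.eq_of_backup_eq (t := k) (t' := k) (ω := ω) (ω' := ω')
      (bonusBackup_congr M b c hω fun i hi => (ih i hi fun j hj => hω j (hj.trans hi.le)).1)
    refine ⟨?_, h1⟩
    rw [h.action, h.action, h1.2, hω k le_rfl]

lemma IsMBIEEBRun.action_eq (h : IsMBIEEBRun P M b c tie s a π) {k : ℕ} {ω ω' : Ω}
    (hω : ω' ∈ historyCylinder s k ω) (i : ℕ) (hi : i ≤ k) : a i ω' = a i ω :=
  (h.eq_of_mem_cylinder i fun j hj => hω j (hj.trans hi)).1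

/-- The transition law conditions on states and actions; since the states determine the actions, it
may be read on cylinders in the states alone. -/
lemma IsMBIEEBRun.measureReal_cylinder_inter (h : IsMBIEEBRun P M b c tie s a π) (k : ℕ) (ω : Ω)
    (y : S) : P.real (historyCylinder s k ω ∩ {ω' | s (k + 1) ω' = y}) =
      P.real (historyCylinder s k ω) * M.T (s k ω) (a k ω) y := by
  have h1 : historyCylinder s k ω = {ω' | ∀ i ≤ k, s i ω' = s i ω ∧ a i ω' = a i ω} := by
    ext ω'
    exact ⟨fun hω i hi => ⟨hω i hi, h.action_eq hω i hi⟩, fun hω i hi => (hω i hi).1⟩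
  have := h.transition k (fun i => s i ω) (fun i => a i ω) y
  rw [← h1] at this
  rw [← this, h1]
  rfl

variable [IsProbabilityMeasure P]

/-- Ville's inequality along a run. -/
lemma IsMBIEEBRun.ville (h : IsMBIEEBRun P M b c tie s a π) {ξ : ℕ → Ω → S → ℝ}
    (hξ : ∀ k ω, ∀ ω' ∈ historyCylinder s k ω, ξ k ω' = ξ k ω)
    (hexp : ∀ k ω, ∑ y, M.T (s k ω) (a k ω) y * Real.exp (ξ k ω y) ≤ 1) (r : ℝ) :
    P.real {ω | ∃ t, r ≤ ∑ i ∈ Finset.range t, ξ i ω (s (i + 1) ω)} ≤ Real.exp (-r) :=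
  measureReal_exists_le_sum_le (h.measurable_state 0) (fun _ _ _ => M.T_nonneg _ _ _)
    h.measureReal_cylinder_inter hξ hexp r

/-- Ville's inequality for a sum over the samples of one pair. -/
lemma IsMBIEEBRun.ville_samples (h : IsMBIEEBRun P M b c tie s a π) (x : S) (u : A) {ψ : S → ℝ}
    (hψ : ∑ y, M.T x u y * Real.exp (ψ y) ≤ 1) (r : ℝ) :
    P.real {ω | ∃ t, r ≤ ∑ i ∈ sampleTimes c (fun i => s i ω) (fun i => a i ω) t x u,
      ψ (s (i + 1) ω)} ≤ Real.exp (-r) := by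
  have := h.ville (ξ := fun k ω y => if (s k ω = x ∧ a k ω = u) ∧
    visitCount (fun i => s i ω) (fun i => a i ω) k x u < c then ψ y else 0) ?_ ?_ r
  · simp_rw [sum_sampleTimes]
    exact this
  · intro k ω ω' hω
    have h1 := visitCount_congr (t := k) (s := fun i => s i ω') (s' := fun i => s i ω)
      (a := fun i => a i ω') (a' := fun i => a i ω) (fun i hi => hω i hi.le)
      (fun i hi => h.action_eq hω i hi.le) x u
    simp only [h1, hω k le_rfl, h.action_eq hω k le_rfl]
  · intro k ω
    split_ifs with hc
    · rw [hc.1.1, hc.1.2]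
      exact hψ
    · simp [M.T_sum]

/-- Hoeffding bound, uniform over pairs, times and sample counts. -/
lemma IsMBIEEBRun.measureReal_deviation_le (h : IsMBIEEBRun P M b c tie s a π) {f : S → ℝ}
    (hf0 : ∀ y, 0 ≤ f y) (hf : ∀ y, f y ≤ M.horizon) {d : ℝ} (hd : 0 ≤ d) :
    P.real {ω | ∃ x u t, sampleCount c (fun i => s i ω) (fun i => a i ω) t x u ≠ 0 ∧
      d * Real.sqrt (sampleCount c (fun i => s i ω) (fun i => a i ω) t x u) <
        ∑ i ∈ sampleTimes c (fun i => s i ω) (fun i => a i ω) t x u,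
          (f (s (i + 1) ω) - ∑ y, M.T x u y * f y)} ≤
      Fintype.card S * Fintype.card A * c * Real.exp (-(2 * d ^ 2 / M.horizon ^ 2)) := by
  have hH := M.horizon_pos
  -- One supermartingale for each possible sample count, with index `n` standing for n + 1 samples.
  -- With N samples, the exponent l d √N - N l² H² / 8 is maximal at l = 4d / (√N H²), where it
  -- equals 2d² / H². The union over counts produces the factor `c`.
  have hone : ∀ (x : S) (u : A) (n : Fin c),
      P.real {ω | ∃ t, 2 * d ^ 2 / M.horizon ^ 2 ≤
        ∑ i ∈ sampleTimes c (fun i => s i ω) (fun i => a i ω) t x u,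
          (4 * d / (Real.sqrt (n + 1) * M.horizon ^ 2) *
            (f (s (i + 1) ω) - ∑ y, M.T x u y * f y) -
            (4 * d / (Real.sqrt (n + 1) * M.horizon ^ 2)) ^ 2 * M.horizon ^ 2 / 8)} ≤
        Real.exp (-(2 * d ^ 2 / M.horizon ^ 2)) := by
    intro x u n
    refine h.ville_samples x u (ψ := fun y => 4 * d / (Real.sqrt (n + 1) * M.horizon ^ 2) *
      (f y - ∑ y, M.T x u y * f y) -
      (4 * d / (Real.sqrt (n + 1) * M.horizon ^ 2)) ^ 2 * M.horizon ^ 2 / 8) ?_ _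
    simp_rw [Real.exp_sub, mul_div_assoc']
    rw [← Finset.sum_div, div_le_one (Real.exp_pos _)]
    exact sum_mul_exp_sub_le (M.T_nonneg x u) (M.T_sum x u) hf0 hf _
  have hsub : {ω | ∃ x u t, sampleCount c (fun i => s i ω) (fun i => a i ω) t x u ≠ 0 ∧
      d * Real.sqrt (sampleCount c (fun i => s i ω) (fun i => a i ω) t x u) <
        ∑ i ∈ sampleTimes c (fun i => s i ω) (fun i => a i ω) t x u,
          (f (s (i + 1) ω) - ∑ y, M.T x u y * f y)} ⊆
      ⋃ z : (S × A) × Fin c, {ω | ∃ t, 2 * d ^ 2 / M.horizon ^ 2 ≤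
        ∑ i ∈ sampleTimes c (fun i => s i ω) (fun i => a i ω) t z.1.1 z.1.2,
          (4 * d / (Real.sqrt (z.2 + 1) * M.horizon ^ 2) *
            (f (s (i + 1) ω) - ∑ y, M.T z.1.1 z.1.2 y * f y) -
            (4 * d / (Real.sqrt (z.2 + 1) * M.horizon ^ 2)) ^ 2 * M.horizon ^ 2 / 8)} := by
    rintro ω ⟨x, u, t, hn, hlt⟩
    have hle := sampleCount_le c (fun i => s i ω) (fun i => a i ω) t x u
    refine Set.mem_iUnion.2 ⟨((x, u), ⟨sampleCount c (fun i => s i ω) (fun i => a i ω) t x u - 1,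
      by omega⟩), t, ?_⟩
    have hcast : ((sampleCount c (fun i => s i ω) (fun i => a i ω) t x u - 1 : ℕ) : ℝ) + 1 =
        sampleCount c (fun i => s i ω) (fun i => a i ω) t x u := by
      rw [← Nat.cast_add_one, Nat.sub_add_cancel (Nat.pos_of_ne_zero hn)]
    simp only [hcast]
    rw [Finset.sum_sub_distrib, ← Finset.mul_sum, Finset.sum_const, nsmul_eq_mul]
    change _ ≤ _ - (sampleCount c (fun i => s i ω) (fun i => a i ω) t x u : ℝ) * _
    set n := sampleCount c (fun i => s i ω) (fun i => a i ω) t x u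
    have hn0 : (0 : ℝ) < n := Nat.cast_pos.2 (Nat.pos_of_ne_zero hn)
    have hs0 : 0 < Real.sqrt n := Real.sqrt_pos.2 hn0
    have h2 : 4 * d / (Real.sqrt n * M.horizon ^ 2) * (d * Real.sqrt n) =
        4 * d ^ 2 / M.horizon ^ 2 := by
      field_simp
    have h3 : n * ((4 * d / (Real.sqrt n * M.horizon ^ 2)) ^ 2 * M.horizon ^ 2 / 8) =
        2 * d ^ 2 / M.horizon ^ 2 := by
      rw [div_pow, mul_pow, mul_pow, Real.sq_sqrt hn0.le]
      field_simp
      ring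
    have h4 := mul_le_mul_of_nonneg_left hlt.le
      (a := 4 * d / (Real.sqrt n * M.horizon ^ 2)) (by positivity)
    rw [h3]
    rw [h2] at h4
    have h5 : 4 * d ^ 2 / M.horizon ^ 2 = 2 * (2 * d ^ 2 / M.horizon ^ 2) := by ring
    linarith
  refine (measureReal_mono hsub).trans ((measureReal_iUnion_fintype_le _).trans
    ((Finset.sum_le_sum fun z _ => hone z.1.1 z.1.2 z.2).trans (le_of_eq ?_)))
  simp

/-- Multiplicative Chernoff bound for all transition frequencies at all times. -/
lemma IsMBIEEBRun.measureReal_frequency_le (h : IsMBIEEBRun P M b c tie s a π) {θ : ℝ}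
    (hθ0 : 0 < θ) (hθ1 : θ ≤ 1) (r : ℝ) :
    P.real {ω | ∃ x u y t,
      sampleCount c (fun i => s i ω) (fun i => a i ω) t x u * ((1 + θ) * M.T x u y) + r / θ <
        ∑ i ∈ sampleTimes c (fun i => s i ω) (fun i => a i ω) t x u,
          if s (i + 1) ω = y then (1 : ℝ) else 0} ≤
      Fintype.card S * Fintype.card A * Fintype.card S * Real.exp (-r) := by
  -- The compensator is linear in the sample count, so a single supermartingale serves all counts
  -- and no factor `c` appears.
  have hone : ∀ (x : S) (u : A) (y : S),
      P.real {ω | ∃ t, r ≤ ∑ i ∈ sampleTimes c (fun i => s i ω) (fun i => a i ω) t x u,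
        (θ * (if s (i + 1) ω = y then 1 else 0) - θ * ((1 + θ) * M.T x u y))} ≤
        Real.exp (-r) := fun x u y =>
    h.ville_samples x u (ψ := fun z => θ * (if z = y then 1 else 0) - θ * ((1 + θ) * M.T x u y))
      (sum_mul_exp_indicator_le (M.T_nonneg x u) (M.T_sum x u) hθ0.le hθ1 y) r
  have hsub : {ω | ∃ x u y t,
      sampleCount c (fun i => s i ω) (fun i => a i ω) t x u * ((1 + θ) * M.T x u y) + r / θ <
        ∑ i ∈ sampleTimes c (fun i => s i ω) (fun i => a i ω) t x u,
          if s (i + 1) ω = y then (1 : ℝ) else 0} ⊆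
      ⋃ z : (S × A) × S, {ω | ∃ t, r ≤
        ∑ i ∈ sampleTimes c (fun i => s i ω) (fun i => a i ω) t z.1.1 z.1.2,
        (θ * (if s (i + 1) ω = z.2 then 1 else 0) - θ * ((1 + θ) * M.T z.1.1 z.1.2 z.2))} := by
    rintro ω ⟨x, u, y, t, hlt⟩
    refine Set.mem_iUnion.2 ⟨((x, u), y), t, ?_⟩
    dsimp only
    rw [Finset.sum_sub_distrib, ← Finset.mul_sum, Finset.sum_const, nsmul_eq_mul]
    change _ ≤ _ - (sampleCount c (fun i => s i ω) (fun i => a i ω) t x u : ℝ) * _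
    have := mul_le_mul_of_nonneg_left hlt.le hθ0.le
    rw [mul_add, mul_div_cancel₀ _ hθ0.ne'] at this
    linarith
  refine (measureReal_mono hsub).trans ((measureReal_iUnion_fintype_le _).trans
    ((Finset.sum_le_sum fun z _ => hone z.1.1 z.1.2 z.2).trans (le_of_eq ?_)))
  simp

end Run

/-! ### Optimism and one-step contraction of the overestimation. -/

section Trajectory

variable {S A : Type*} [Fintype S] [Fintype A] [DecidableEq S] [DecidableEq A]
  {M : MDP S A} {b : ℝ} {c : ℕ} {s : ℕ → S} {a : ℕ → A} {t : ℕ} {V : S → ℝ}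

lemma div_sqrt_mul_eq (d : ℝ) {n : ℝ} (hn : 0 < n) : d * Real.sqrt n / n = d / Real.sqrt n := by
  have h0 : 0 < Real.sqrt n := Real.sqrt_pos.2 hn
  rw [div_eq_div_iff hn.ne' h0.ne', mul_assoc, Real.mul_self_sqrt hn.le]

variable [Nonempty A] in
/-- If the optimal value is not underestimated by more than the bonus, then the solution of the
MBIE-EB equation is optimistic. -/
lemma IsBonusValue.optValue_le (hV : IsBonusValue M b c s a t V) (hb : 0 ≤ b)
    (hdev : ∀ x u, sampleCount c s a t x u ≠ 0 →
      ∑ i ∈ sampleTimes c s a t x u, ((M.horizon - M.optValue (s (i + 1))) -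
        ∑ y, M.T x u y * (M.horizon - M.optValue y)) ≤ b * Real.sqrt (sampleCount c s a t x u))
    (x : S) : M.optValue x ≤ V x := by
  have := hV.le_add_of_subsolution (V' := M.optValue) le_rfl (fun x => ?_) x
  · simpa using this
  obtain ⟨u, hu⟩ := M.exists_optValue_le x
  refine ⟨u, ?_⟩
  rw [add_zero]
  by_cases hn : sampleCount c s a t x u = 0
  · rw [bonusBackup_of_eq_zero M b hn]
    exact M.optValue_le_horizon x
  · rw [bonusBackup_of_ne_zero M b hn]
    have h1 := hdev x u hn
    have h2 : ∑ y, M.T x u y * (M.horizon - M.optValue y) =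
        M.horizon - ∑ y, M.T x u y * M.optValue y := by
      simp_rw [mul_sub]
      rw [Finset.sum_sub_distrib, ← Finset.sum_mul, M.T_sum, one_mul]
    simp_rw [h2, sub_sub_sub_cancel_left] at h1
    rw [Finset.sum_sub_distrib, Finset.sum_const, nsmul_eq_mul] at h1
    change (sampleCount c s a t x u : ℝ) * _ - _ ≤ _ at h1
    have hn0 : (0 : ℝ) < sampleCount c s a t x u := Nat.cast_pos.2 (Nat.pos_of_ne_zero hn)
    have h3 : ∑ y, M.T x u y * M.optValue y -
        (∑ i ∈ sampleTimes c s a t x u, M.optValue (s (i + 1))) / sampleCount c s a t x u ≤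
        b / Real.sqrt (sampleCount c s a t x u) := by
      rw [← div_sqrt_mul_eq b hn0, le_div_iff₀ hn0, sub_mul, div_mul_cancel₀ _ hn0.ne']
      linarith
    have h4 : 0 ≤ b / Real.sqrt (sampleCount c s a t x u) := by positivity
    nlinarith [M.γ_nonneg, M.γ_lt_one]

/-- One-step bound for the overestimation `V - W` at a pair that has been tried. -/
lemma overestimation_le {d r Vm : ℝ} {x : S} {u : A} {W : S → ℝ}
    (hr : 0 ≤ r) (hVx : V x = bonusBackup M b c s a t V x u)
    (hWx : W x = M.R x u + M.γ * ∑ y, M.T x u y * W y) (hW0 : ∀ y, 0 ≤ W y)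
    (hW : ∀ y, W y ≤ M.optValue y) (hopt : ∀ y, M.optValue y ≤ V y) (hVm : ∀ y, V y ≤ Vm)
    (hd : 0 ≤ d) (hn : sampleCount c s a t x u ≠ 0)
    (hdev : ∑ i ∈ sampleTimes c s a t x u, (M.optValue (s (i + 1)) -
        ∑ y, M.T x u y * M.optValue y) ≤ d * Real.sqrt (sampleCount c s a t x u))
    (hfreq : ∀ y, ∑ i ∈ sampleTimes c s a t x u, (if s (i + 1) = y then (1 : ℝ) else 0) ≤
      sampleCount c s a t x u * ((1 + (1 - M.γ) / 2) * M.T x u y) + r / ((1 - M.γ) / 2)) :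
    V x - W x ≤ (1 - (1 - M.γ) / 2) * ∑ y, M.T x u y * (V y - W y) +
      ((b + d) / Real.sqrt (sampleCount c s a t x u) +
        Fintype.card S * (r / ((1 - M.γ) / 2)) * Vm / sampleCount c s a t x u) := by
  have hn0 : (0 : ℝ) < sampleCount c s a t x u := Nat.cast_pos.2 (Nat.pos_of_ne_zero hn)
  have hw := M.one_sub_γ_pos
  rw [hVx, hWx, bonusBackup_of_ne_zero M b hn]
  set n : ℝ := ((sampleCount c s a t x u : ℕ) : ℝ)
  set K : ℝ := Fintype.card S * (r / ((1 - M.γ) / 2)) * Vm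
  have hVm0 : 0 ≤ Vm := (hW0 x).trans ((hW x).trans ((hopt x).trans (hVm x)))
  have hK0 : 0 ≤ K := by positivity
  have h1 : (∑ i ∈ sampleTimes c s a t x u, M.optValue (s (i + 1))) / n ≤
      ∑ y, M.T x u y * M.optValue y + d / Real.sqrt n := by
    rw [Finset.sum_sub_distrib, Finset.sum_const, nsmul_eq_mul] at hdev
    change _ - n * _ ≤ _ at hdev
    rw [← div_sqrt_mul_eq d hn0, div_le_iff₀ hn0, add_mul, div_mul_cancel₀ _ hn0.ne']
    linarith
  -- The weights V - V* are data-dependent but nonnegative by optimism, so the upper bounds on the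
  -- frequencies may be summed against them.
  have h2 : (∑ i ∈ sampleTimes c s a t x u, (V (s (i + 1)) - M.optValue (s (i + 1)))) / n ≤
      (1 + (1 - M.γ) / 2) * ∑ y, M.T x u y * (V y - M.optValue y) + K / n := by
    have e1 : ∑ i ∈ sampleTimes c s a t x u, (V (s (i + 1)) - M.optValue (s (i + 1))) =
        ∑ y, (∑ i ∈ sampleTimes c s a t x u, (if s (i + 1) = y then (1 : ℝ) else 0)) *
          (V y - M.optValue y) := by
      simp_rw [Finset.sum_mul]
      rw [Finset.sum_comm]
      refine Finset.sum_congr rfl fun i _ => ?_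
      simp
    have e2 : ∑ y, (∑ i ∈ sampleTimes c s a t x u, (if s (i + 1) = y then (1 : ℝ) else 0)) *
          (V y - M.optValue y) ≤
        ∑ y, (n * ((1 + (1 - M.γ) / 2) * (M.T x u y * (V y - M.optValue y))) +
          r / ((1 - M.γ) / 2) * Vm) := by
      refine Finset.sum_le_sum fun y _ => ?_
      have f1 := mul_le_mul_of_nonneg_right (hfreq y) (sub_nonneg.2 (hopt y))
      have f2 : r / ((1 - M.γ) / 2) * (V y - M.optValue y) ≤ r / ((1 - M.γ) / 2) * Vm := by
        refine mul_le_mul_of_nonneg_left ?_ (by positivity)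
        linarith [hVm y, hW0 y, hW y]
      linarith
    rw [Finset.sum_add_distrib, Finset.sum_const, nsmul_eq_mul, ← Finset.mul_sum,
      ← Finset.mul_sum, Finset.card_univ, ← mul_assoc (Fintype.card S : ℝ)] at e2
    rw [e1, div_le_iff₀ hn0, add_mul, div_mul_cancel₀ _ hn0.ne']
    exact e2.trans (le_of_eq (by ring))
  have h3 : ∑ i ∈ sampleTimes c s a t x u, V (s (i + 1)) =
      ∑ i ∈ sampleTimes c s a t x u, M.optValue (s (i + 1)) +
      ∑ i ∈ sampleTimes c s a t x u, (V (s (i + 1)) - M.optValue (s (i + 1))) := by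
    rw [Finset.sum_sub_distrib]
    ring
  have h4 : ∑ y, M.T x u y * (V y - M.optValue y) ≤ ∑ y, M.T x u y * (V y - W y) :=
    Finset.sum_le_sum fun y _ =>
      mul_le_mul_of_nonneg_left (by linarith [hW y]) (M.T_nonneg x u y)
  have h5 : 0 ≤ ∑ y, M.T x u y * (V y - W y) :=
    M.sum_T_mul_nonneg x u fun y => by linarith [hW y, hopt y]
  have h6 : ∑ y, M.T x u y * (V y - W y) =
      ∑ y, M.T x u y * (V y - M.optValue y) + ∑ y, M.T x u y * M.optValue y -
        ∑ y, M.T x u y * W y := by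
    rw [← Finset.sum_add_distrib, ← Finset.sum_sub_distrib]
    exact Finset.sum_congr rfl fun y _ => by ring
  have h7 : (∑ i ∈ sampleTimes c s a t x u, V (s (i + 1))) / n - ∑ y, M.T x u y * W y ≤
      (1 + (1 - M.γ) / 2) * ∑ y, M.T x u y * (V y - W y) + (d / Real.sqrt n + K / n) := by
    rw [h3, add_div]
    nlinarith
  have h8 : 0 ≤ d / Real.sqrt n + K / n := by positivity
  have h9 := mul_le_mul_of_nonneg_left h7 M.γ_nonneg
  have h10 : M.γ * (d / Real.sqrt n + K / n) ≤ d / Real.sqrt n + K / n :=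
    mul_le_of_le_one_left h8 M.γ_lt_one.le
  -- With w = 1 - γ: (1 - w)(1 + w/2) = 1 - w/2 - w²/2. Half of the discount gap pays for the
  -- multiplicative error in the frequencies.
  have h11 : M.γ * ((1 + (1 - M.γ) / 2) * ∑ y, M.T x u y * (V y - W y)) ≤
      (1 - (1 - M.γ) / 2) * ∑ y, M.T x u y * (V y - W y) := by
    rw [← mul_assoc]
    refine mul_le_mul_of_nonneg_right ?_ h5
    nlinarith [M.γ_lt_one]
  rw [add_div]
  linarith

/-- The overestimation of the value of `π` by `V` beyond `ε / 2`. -/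
def excess (M : MDP S A) (ε : ℝ) (V : S → ℝ) (π : S → A) (x : S) : ℝ :=
  max (V x - M.value (detPolicy π) x - ε / 2) 0

/-- Bound for the one-step growth of the excess at a pair with `n` samples. -/
def stepError (h e K : ℝ) (c n : ℕ) : ℝ :=
  if n = 0 then h else if n < c then e / Real.sqrt n + K / n else 0

/-- Bound for the total cost of the `(n + 1)`-st sample of a pair: one-step error and change of
the current policy. -/
def sampleCost (h Vm e K : ℝ) (n : ℕ) : ℝ :=
  if n = 0 then 2 * h + Vm else h + e / Real.sqrt n + (K + 2 * h * Vm) / n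

/-- Subtracting ε/2 in the potential pays off for a saturated pair: by `hsmall`, its remaining error
fits into the part (1 - q) ε/2 that the contraction frees. Thus only unsaturated pairs contribute,
the untried ones through the trivial bound `h`. -/
lemma excess_step_le {ε e K Q x' : ℝ} {n : ℕ} {q : ℝ} {h : ℝ} (hq0 : 0 ≤ q) (hq1 : q ≤ 1)
    (hε : 0 ≤ ε) (hc : 0 < c) (hn : n ≤ c) (he : 0 ≤ e) (hK : 0 ≤ K) (hh : 0 ≤ h) (hQ0 : 0 ≤ Q)
    (hsmall : e / Real.sqrt c + K / c ≤ (1 - q) * (ε / 2))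
    (hzero : n = 0 → x' ≤ h)
    (hstep : n ≠ 0 → x' ≤ q * (Q + ε / 2) + (e / Real.sqrt n + K / n)) :
    max (x' - ε / 2) 0 ≤ stepError h e K c n + q * Q := by
  have hqQ : 0 ≤ q * Q := mul_nonneg hq0 hQ0
  have hqe : q * (ε / 2) ≤ ε / 2 := mul_le_of_le_one_left (by linarith) hq1
  unfold stepError
  split_ifs with h0 h1
  · exact max_le (by linarith [hzero h0]) (by linarith)
  · have : 0 ≤ e / Real.sqrt n + K / n := by positivity
    exact max_le (by linarith [hstep h0]) (by linarith)
  · obtain rfl : n = c := by omega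
    exact max_le (by linarith [hstep h0]) (by linarith)

end Trajectory

/-! ### Charging costs to samples. -/

section Counting

variable {S A : Type*} [Fintype S] [Fintype A] [DecidableEq S] [DecidableEq A]

/-- Sums over the samples taken before time `t`, rearranged by pairs and sample counts. -/
lemma sum_sampled_eq (c : ℕ) (s : ℕ → S) (a : ℕ → A) (G : ℕ → ℝ) (t : ℕ) :
    ∑ i ∈ Finset.range t, (if sampleCount c s a i (s i) (a i) < c then
      G (sampleCount c s a i (s i) (a i)) else 0) =
    ∑ z : S × A, ∑ n ∈ Finset.range (sampleCount c s a t z.1 z.2), G n := by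
  induction t with
  | zero => simp [show ∀ x u, sampleCount c s a 0 x u = 0 from fun _ _ => rfl]
  | succ t ih =>
    rw [Finset.sum_range_succ, ih]
    have h1 : ∀ z : S × A, ∑ n ∈ Finset.range (sampleCount c s a (t + 1) z.1 z.2), G n =
        ∑ n ∈ Finset.range (sampleCount c s a t z.1 z.2), G n +
          if z = (s t, a t) then (if sampleCount c s a t (s t) (a t) < c then
            G (sampleCount c s a t (s t) (a t)) else 0) else 0 := by
      rintro ⟨x, u⟩
      rw [sampleCount_succ]
      simp only [visitCount_lt_iff, Prod.mk.injEq]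
      by_cases hz : x = s t ∧ u = a t
      · obtain ⟨rfl, rfl⟩ := hz
        by_cases hc : sampleCount c s a t (s t) (a t) < c
        · simp [hc, Finset.sum_range_succ]
        · simp [hc]
      · have hz' : ¬ (s t = x ∧ a t = u) := fun h => hz ⟨h.1.symm, h.2.symm⟩
        simp [hz, hz']
    simp_rw [h1]
    rw [Finset.sum_add_distrib, Finset.sum_ite_eq' Finset.univ]
    simp

lemma sum_sampled_le (c : ℕ) (s : ℕ → S) (a : ℕ → A) {G : ℕ → ℝ} (hG : ∀ n, 0 ≤ G n) (t : ℕ) :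
    ∑ i ∈ Finset.range t, (if sampleCount c s a i (s i) (a i) < c then
      G (sampleCount c s a i (s i) (a i)) else 0) ≤
    Fintype.card S * Fintype.card A * ∑ n ∈ Finset.range c, G n := by
  rw [sum_sampled_eq]
  calc _ ≤ ∑ z : S × A, ∑ n ∈ Finset.range c, G n := by
        refine Finset.sum_le_sum fun z _ => ?_
        refine Finset.sum_le_sum_of_subset_of_nonneg ?_ fun n _ _ => hG n
        exact Finset.range_mono (sampleCount_le c s a t z.1 z.2)
    _ = _ := by simp

end Counting

/-! ### From contraction in expectation to an exponential supermartingale. -/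

section Potential

/-- A bounded potential that contracts by `1 - w / 2` in expectation yields an exponential
supermartingale with the slightly weaker contraction factor `1 - w / 4`. -/
lemma sum_mul_exp_potential_le {S : Type*} [Fintype S] {q D : S → ℝ} {w B Y Vm : ℝ}
    (hq : ∀ y, 0 ≤ q y) (hq1 : ∑ y, q y = 1) (hw0 : 0 < w) (hw1 : w ≤ 1) (hVm : 0 < Vm)
    (hD0 : ∀ y, 0 ≤ D y) (hD : ∀ y, D y ≤ Vm) (hY : Y ≤ B + (1 - w / 2) * ∑ y, q y * D y) :
    ∑ y, q y * Real.exp (w / (2 * Vm) * (Y - B - (1 - w / 4) * D y)) ≤ 1 := by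
  -- At this scale l D ≤ w/2, so the quadratic term of the exponential can be paid for by weakening
  -- the factor from 1 - w/2 to 1 - w/4.
  set l := w / (2 * Vm) with hl
  have hl0 : 0 < l := by positivity
  have hlV : l * Vm = w / 2 := by
    rw [hl]
    field_simp
  have hm0 : 0 ≤ ∑ y, q y * D y := Finset.sum_nonneg fun y _ => mul_nonneg (hq y) (hD0 y)
  have h1 : ∀ y, Real.exp (-(l * ((1 - w / 4) * D y))) ≤ 1 - l * (1 - w / 2) * D y := by
    intro y
    set z := l * ((1 - w / 4) * D y) with hz
    have hlD : 0 ≤ l * D y := mul_nonneg hl0.le (hD0 y)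
    have hlD' : l * D y ≤ w / 2 := hlV ▸ mul_le_mul_of_nonneg_left (hD y) hl0.le
    have hz' : z = (1 - w / 4) * (l * D y) := by rw [hz]; ring
    have hz0 : 0 ≤ z := by rw [hz']; exact mul_nonneg (by linarith) hlD
    have hz1 : z ≤ w / 2 := by rw [hz']; nlinarith
    -- Because (1 + z + z²/2)(1 - z + z²/2) = 1 + z⁴/4 ≥ 1.
    have e1 : Real.exp (-z) ≤ 1 - z + z ^ 2 / 2 := by
      rw [Real.exp_neg, inv_le_iff_one_le_mul₀ (Real.exp_pos z)]
      have e2 := Real.quadratic_le_exp_of_nonneg hz0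
      have e3 : 0 ≤ 1 - z + z ^ 2 / 2 := by nlinarith [sq_nonneg (z - 1)]
      nlinarith [mul_le_mul_of_nonneg_left e2 e3, sq_nonneg (z ^ 2)]
    have e4 : 1 - z + z ^ 2 / 2 ≤ 1 - (1 - w / 4) * z := by nlinarith
    have e5 : l * (1 - w / 2) * D y ≤ (1 - w / 4) * z := by
      rw [hz']
      nlinarith [mul_nonneg (sq_nonneg w) hlD]
    linarith
  calc ∑ y, q y * Real.exp (l * (Y - B - (1 - w / 4) * D y))
      = Real.exp (l * (Y - B)) * ∑ y, q y * Real.exp (-(l * ((1 - w / 4) * D y))) := by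
        rw [Finset.mul_sum]
        refine Finset.sum_congr rfl fun y _ => ?_
        rw [mul_sub, sub_eq_add_neg, Real.exp_add]
        ring
    _ ≤ Real.exp (l * (Y - B)) * ∑ y, q y * (1 - l * (1 - w / 2) * D y) := by
        gcongr with y
        · exact hq y
        · exact h1 y
    _ = Real.exp (l * (Y - B)) * (1 - l * ((1 - w / 2) * ∑ y, q y * D y)) := by
        congr 1
        simp_rw [mul_sub, mul_one]
        rw [Finset.sum_sub_distrib, hq1, Finset.mul_sum, Finset.mul_sum]
        congr 1
        exact Finset.sum_congr rfl fun y _ => by ring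
    _ ≤ Real.exp (l * (Y - B)) * Real.exp (-(l * ((1 - w / 2) * ∑ y, q y * D y))) := by
        gcongr
        exact Real.one_sub_le_exp_neg _
    _ ≤ 1 := by
        rw [← Real.exp_add, Real.exp_le_one_iff]
        nlinarith

end Potential

/-! ### Pathwise telescoping of the potential. -/

section Counting

/-- Deterministic accounting: a potential that contracts up to errors and jumps, each charged to a
sample, is large only a bounded number of times. -/
lemma card_mul_le_of_potential {ε w Vm r : ℝ} {Y E D B G : ℕ → ℝ} (hw : 0 < w) (hw1 : w ≤ 1)
    (hVm : 0 < Vm) (hY0 : ∀ i, 0 ≤ Y i) (hYV : ∀ i, Y i ≤ Vm)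
    (hsum : ∀ t, ∑ i ∈ Finset.range t, w / (2 * Vm) * (Y i - B i - (1 - w / 4) * D i) < r)
    (hjump : ∀ i, D i ≤ Y (i + 1) + E i) (hG : ∀ i, B i + E i ≤ G i) (hE : ∀ i, 0 ≤ E i)
    {p : ℕ → Prop} [DecidablePred p] (hp : ∀ i, p i → ε / 2 ≤ Y i) (t : ℕ) :
    (((Finset.range t).filter p).card : ℝ) * (ε * w / 8) ≤
      Vm + 2 * Vm * r / w + ∑ i ∈ Finset.range t, G i := by
  have h1 : ((Finset.range t).filter p).card * (ε / 2) ≤ ∑ i ∈ Finset.range t, Y i := by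
    calc ((Finset.range t).filter p).card * (ε / 2)
        = ∑ i ∈ (Finset.range t).filter p, ε / 2 := by rw [Finset.sum_const, nsmul_eq_mul]
      _ ≤ ∑ i ∈ (Finset.range t).filter p, Y i :=
        Finset.sum_le_sum fun i hi => hp i (Finset.mem_filter.1 hi).2
      _ ≤ ∑ i ∈ Finset.range t, Y i :=
        Finset.sum_le_sum_of_subset_of_nonneg (Finset.filter_subset _ _) fun i _ _ => hY0 i
  have h2 : ∑ i ∈ Finset.range t, (Y i - B i - (1 - w / 4) * D i) ≤ 2 * Vm * r / w := by
    have := (hsum t).le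
    rw [← Finset.mul_sum, div_mul_eq_mul_div, div_le_iff₀ (by positivity)] at this
    rw [le_div_iff₀ hw]
    linarith
  have h3 : ∑ i ∈ Finset.range t, (Y i - (1 - w / 4) * Y (i + 1) - G i) ≤
      ∑ i ∈ Finset.range t, (Y i - B i - (1 - w / 4) * D i) := by
    refine Finset.sum_le_sum fun i _ => ?_
    have := mul_le_mul_of_nonneg_left (hjump i) (a := 1 - w / 4) (by linarith)
    nlinarith [hG i, hE i]
  -- The differences Y (i + 1) - Y i telescope; the contraction leaves the weight w/4 on the sum of
  -- the potential.
  have h4 : ∑ i ∈ Finset.range t, (Y i - (1 - w / 4) * Y (i + 1) - G i) =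
      w / 4 * ∑ i ∈ Finset.range t, Y i - (1 - w / 4) * (Y t - Y 0) -
        ∑ i ∈ Finset.range t, G i := by
    have e : ∀ i, Y i - (1 - w / 4) * Y (i + 1) - G i =
        w / 4 * Y i - (1 - w / 4) * (Y (i + 1) - Y i) - G i := fun i => by ring
    simp_rw [e]
    rw [Finset.sum_sub_distrib, Finset.sum_sub_distrib, ← Finset.mul_sum, ← Finset.mul_sum,
      Finset.sum_range_sub]
  have h5 : (1 - w / 4) * (Y t - Y 0) ≤ Vm := by nlinarith [hY0 t, hY0 0, hYV t]
  have h6 := mul_le_mul_of_nonneg_left h1 (a := w / 4) (by linarith)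
  nlinarith

end Counting

/-! ### The excess as a potential. -/

section Excess

variable {S A : Type*} [Fintype S] [Fintype A] [DecidableEq S] [DecidableEq A]

lemma excess_nonneg (M : MDP S A) (ε : ℝ) (V : S → ℝ) (π : S → A) (x : S) :
    0 ≤ excess M ε V π x := le_max_right _ _

lemma excess_le (M : MDP S A) {ε Vm : ℝ} (hε : 0 ≤ ε) {V : S → ℝ} {x : S} (hVm : 0 ≤ Vm)
    (hV : V x ≤ Vm) (π : S → A) : excess M ε V π x ≤ Vm :=
  max_le (by linarith [M.value_nonneg π x]) hVm

lemma le_excess_add (M : MDP S A) (ε : ℝ) (V : S → ℝ) (π : S → A) (x : S) :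
    V x - M.value (detPolicy π) x ≤ excess M ε V π x + ε / 2 := by
  have := le_max_left (V x - M.value (detPolicy π) x - ε / 2) 0
  unfold excess
  linarith

/-- The two policies are unrelated, so exchanging them may cost a full horizon. This is why every
sample is charged at least H, the dominant cost. -/
lemma excess_le_add (M : MDP S A) (ε : ℝ) {V V' : S → ℝ} (π π' : S → A) {x : S} {κ : ℝ}
    (hκ : 0 ≤ κ) (hV : V x ≤ V' x + κ) :
    excess M ε V π x ≤ excess M ε V' π' x + (M.horizon + κ) := by
  have h1 := M.value_le_horizon π' x
  have h2 := M.value_nonneg π x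
  have h3 := le_excess_add M ε V' π' x
  have h4 := excess_nonneg M ε V' π' x
  have h5 := M.horizon_pos
  exact max_le (by linarith) (by linarith)

end Excess

/-! ### Sample complexity of a run for general parameters. -/

section Run

open MeasureTheory

variable {S A Ω : Type*} [Fintype S] [Fintype A] [DecidableEq S] [DecidableEq A] [Nonempty A]
  [MeasurableSpace Ω] {P : Measure Ω} {M : MDP S A} {b : ℝ} {c : ℕ} {tie : S → (A → ℝ) → A}
  {s : ℕ → Ω → S} {a : ℕ → Ω → A} {π : ℕ → Ω → S → A}

/-- The excess of the current policy changes only when a sample is taken, and then not much. -/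
lemma IsMBIEEBRun.excess_le_succ (h : IsMBIEEBRun P M b c tie s a π) (hb : 0 ≤ b) {ε : ℝ}
    (i : ℕ) (ω : Ω) (y : S) {n : ℕ}
    (hn : n = sampleCount c (fun i => s i ω) (fun i => a i ω) i (s i ω) (a i ω)) :
    excess M ε (h.bonusValue i ω) (π i ω) y ≤
      excess M ε (h.bonusValue (i + 1) ω) (π (i + 1) ω) y +
        if n < c then (if n = 0 then M.horizon + M.horizon * (1 + b)
          else M.horizon + 2 * M.horizon * (M.horizon * (1 + b)) / n) else 0 := by
  have hH := M.one_le_horizon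
  have hV := h.isBonusValue i ω
  have hV' := h.isBonusValue (i + 1) ω
  split_ifs with hc h0
  -- At the first sample of a pair nothing better is known than that V stays within [0, H(1 + b)].
  · refine excess_le_add M ε _ _ (by positivity) ?_
    linarith [hV.le hb y, hV'.nonneg hb y]
  -- The old solution is a subsolution of the new equation up to κ; the comparison principle
  -- amplifies κ by the horizon.
  · have key := hV'.le_add_of_subsolution (V' := h.bonusValue i ω)
      (κ := (M.horizon * (1 + b) + b) / n) (by positivity) (fun x => ?_) y
    · refine excess_le_add M ε _ _ (by positivity) (key.trans ?_)
      have hn0 : (0 : ℝ) < n := Nat.cast_pos.2 (Nat.pos_of_ne_zero h0)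
      have : M.horizon * ((M.horizon * (1 + b) + b) / n) ≤
          2 * M.horizon * (M.horizon * (1 + b)) / n := by
        rw [mul_div_assoc']
        refine div_le_div_of_nonneg_right ?_ hn0.le
        have : b ≤ M.horizon * (1 + b) := by nlinarith
        nlinarith
      linarith
    · obtain ⟨u, hu⟩ := hV.exists_eq x
      refine ⟨u, ?_⟩
      conv_lhs => rw [hu]
      rw [hn]
      exact bonusBackup_le_succ_add M hb (hV.nonneg hb) (hV.le hb) (hn ▸ h0) x u
  -- The visited pair is saturated, so the equation, its solution and the policy stay the same.
  · have heq := h.eq_of_backup_eq (t := i) (t' := i + 1) (ω := ω) (ω' := ω) fun V x u => by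
      refine bonusBackup_succ_of_not_sampled M b ?_ V
      rintro ⟨⟨rfl, rfl⟩, hlt⟩
      rw [visitCount_lt_iff, ← hn] at hlt
      exact hc hlt
    rw [heq.1, heq.2, add_zero]

/-- Outcomes for which the empirical means and frequencies are accurate. -/
structure IsAccurate (M : MDP S A) (b d r : ℝ) (c : ℕ) (s : ℕ → S) (a : ℕ → A) : Prop where
  lower : ∀ x u t, sampleCount c s a t x u ≠ 0 →
    ∑ i ∈ sampleTimes c s a t x u, ((M.horizon - M.optValue (s (i + 1))) -
      ∑ y, M.T x u y * (M.horizon - M.optValue y)) ≤ b * Real.sqrt (sampleCount c s a t x u)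
  upper : ∀ x u t, sampleCount c s a t x u ≠ 0 →
    ∑ i ∈ sampleTimes c s a t x u, (M.optValue (s (i + 1)) - ∑ y, M.T x u y * M.optValue y) ≤
      d * Real.sqrt (sampleCount c s a t x u)
  frequency : ∀ x u y t,
    ∑ i ∈ sampleTimes c s a t x u, (if s (i + 1) = y then (1 : ℝ) else 0) ≤
      sampleCount c s a t x u * ((1 + (1 - M.γ) / 2) * M.T x u y) + r / ((1 - M.γ) / 2)

/-- On accurate outcomes the excess of the current policy contracts along the true transitions. -/
lemma IsMBIEEBRun.excess_le (h : IsMBIEEBRun P M b c tie s a π) (htie : IsGreedyRule tie)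
    {d r ε : ℝ} (hb : 0 ≤ b) (hd : 0 ≤ d) (hr : 0 ≤ r) (hε : 0 ≤ ε) (hc : 0 < c)
    (hsmall : (b + d) / Real.sqrt c +
      Fintype.card S * (r / ((1 - M.γ) / 2)) * (M.horizon * (1 + b)) / c ≤
      (1 - M.γ) / 2 * (ε / 2)) {ω : Ω}
    (hacc : IsAccurate M b d r c (fun i => s i ω) (fun i => a i ω)) (i : ℕ) :
    excess M ε (h.bonusValue i ω) (π i ω) (s i ω) ≤
      stepError M.horizon (b + d)
        (Fintype.card S * (r / ((1 - M.γ) / 2)) * (M.horizon * (1 + b))) c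
        (sampleCount c (fun i => s i ω) (fun i => a i ω) i (s i ω) (a i ω)) +
      (1 - (1 - M.γ) / 2) *
        ∑ y, M.T (s i ω) (a i ω) y * excess M ε (h.bonusValue i ω) (π i ω) y := by
  have hw := M.one_sub_γ_pos
  have hγ := M.γ_nonneg
  have hH := M.horizon_pos
  have hV := h.isBonusValue i ω
  have hopt := hV.optValue_le hb (fun x u => hacc.lower x u i)
  have hVx := h.bonusValue_eq htie i ω (s i ω)
  have hWx := M.value_eq (π i ω) (s i ω)
  rw [← h.action] at hVx hWx
  refine excess_step_le (by linarith) (by linarith) hε hc (sampleCount_le c _ _ _ _ _)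
    (by positivity) (by positivity) hH.le
    (M.sum_T_mul_nonneg _ _ fun y => excess_nonneg M ε _ _ y) (by linarith) ?_ ?_
  · intro h0
    rw [hVx, bonusBackup_of_eq_zero M b h0]
    linarith [M.value_nonneg (π i ω) (s i ω)]
  · intro h0
    refine (overestimation_le hr hVx hWx (M.value_nonneg _) (M.value_le_optValue _) hopt
      (hV.le hb) hd h0 (hacc.upper _ _ i h0) fun y => hacc.frequency _ _ y i).trans ?_
    gcongr
    · linarith
    · calc _ ≤ ∑ y, M.T (s i ω) (a i ω) y *
            (excess M ε (h.bonusValue i ω) (π i ω) y + ε / 2) :=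
          Finset.sum_le_sum fun y _ => mul_le_mul_of_nonneg_left
            (le_excess_add M ε _ _ y) (M.T_nonneg _ _ _)
        _ = _ := by
          simp_rw [mul_add]
          rw [Finset.sum_add_distrib, ← Finset.sum_mul _ _ (ε / 2), M.T_sum, one_mul]

variable [IsProbabilityMeasure P]

/-- The accumulated growth of the excess is bounded with high probability. -/
lemma IsMBIEEBRun.measureReal_growth_le (h : IsMBIEEBRun P M b c tie s a π) (hb : 0 ≤ b)
    {ε : ℝ} (hε : 0 ≤ ε) (K e r : ℝ) :
    P.real {ω | (∀ i, excess M ε (h.bonusValue i ω) (π i ω) (s i ω) ≤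
        stepError M.horizon e K c
          (sampleCount c (fun i => s i ω) (fun i => a i ω) i (s i ω) (a i ω)) +
        (1 - (1 - M.γ) / 2) *
          ∑ y, M.T (s i ω) (a i ω) y * excess M ε (h.bonusValue i ω) (π i ω) y) ∧
      ∃ t, r ≤ ∑ i ∈ Finset.range t, (1 - M.γ) / (2 * (M.horizon * (1 + b))) *
        (excess M ε (h.bonusValue i ω) (π i ω) (s i ω) - stepError M.horizon e K c
          (sampleCount c (fun i => s i ω) (fun i => a i ω) i (s i ω) (a i ω)) -
          (1 - (1 - M.γ) / 4) * excess M ε (h.bonusValue i ω) (π i ω) (s (i + 1) ω))} ≤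
      Real.exp (-r) := by
  classical
  have hH := M.horizon_pos
  have hw := M.one_sub_γ_pos
  -- Ville's inequality needs its moment bound at every outcome, so an increment is set to zero
  -- whenever the contraction fails at that step. On the event in question this truncation never
  -- acts.
  refine le_trans (measureReal_mono ?_) (h.ville (ξ := fun i ω y =>
    if excess M ε (h.bonusValue i ω) (π i ω) (s i ω) ≤
        stepError M.horizon e K c
          (sampleCount c (fun i => s i ω) (fun i => a i ω) i (s i ω) (a i ω)) +
        (1 - (1 - M.γ) / 2) *
          ∑ y, M.T (s i ω) (a i ω) y * excess M ε (h.bonusValue i ω) (π i ω) y then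
      (1 - M.γ) / (2 * (M.horizon * (1 + b))) *
        (excess M ε (h.bonusValue i ω) (π i ω) (s i ω) - stepError M.horizon e K c
          (sampleCount c (fun i => s i ω) (fun i => a i ω) i (s i ω) (a i ω)) -
          (1 - (1 - M.γ) / 4) * excess M ε (h.bonusValue i ω) (π i ω) y)
    else 0) ?_ ?_ r)
  · rintro ω ⟨hstep, t, ht⟩
    refine ⟨t, ht.trans (le_of_eq ?_)⟩
    refine Finset.sum_congr rfl fun i _ => ?_
    rw [if_pos (hstep i)]
  · intro k ω ω' hω
    obtain ⟨h1, h2, h3⟩ := h.eq_of_mem_cylinder k hω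
    have h4 := sampleCount_congr (t := k) (s := fun i => s i ω') (s' := fun i => s i ω)
      (a := fun i => a i ω') (a' := fun i => a i ω) (fun i hi => hω i hi.le)
      (fun i hi => h.action_eq hω i hi.le) c
    simp only [h1, h2, h3, h4, hω k le_rfl]
  · intro k ω
    split_ifs with hc
    · refine sum_mul_exp_potential_le (M.T_nonneg _ _) (M.T_sum _ _) hw
        (by linarith [M.γ_nonneg]) (by positivity) (fun y => excess_nonneg M ε _ _ y)
        (fun y => ?_) hc
      exact _root_.excess_le M hε (by positivity) ((h.isBonusValue k ω).le hb y) _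
    · simp [M.T_sum]

lemma stepError_add_le (h Vm e K : ℝ) {c n : ℕ} (hn : n ≤ c) (hc : 0 < c) :
    stepError h e K c n + (if n < c then (if n = 0 then h + Vm else h + 2 * h * Vm / n) else 0) ≤
      if n < c then sampleCost h Vm e K n else 0 := by
  unfold stepError sampleCost
  split_ifs with h0 h1 h1
  · linarith
  · omega
  · rw [add_div]
    linarith
  · simp

/-- **Sample complexity of MBIE-EB**, up to the choice of the parameters: outside an event of small
probability, the current policy is `ε`-optimal at the current state at all but few times. -/
theorem IsMBIEEBRun.measureReal_card_suboptimal_le (h : IsMBIEEBRun P M b c tie s a π)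
    (htie : IsGreedyRule tie) {d r r' ε : ℝ} (hb : 0 ≤ b) (hd : 0 ≤ d) (hr : 0 ≤ r)
    (hε : 0 < ε) (hc : 0 < c)
    (hsmall : (b + d) / Real.sqrt c +
      Fintype.card S * (r / ((1 - M.γ) / 2)) * (M.horizon * (1 + b)) / c ≤
      (1 - M.γ) / 2 * (ε / 2)) (p : ℕ → Ω → Prop) [∀ ω, DecidablePred fun i => p i ω]
    (hp : ∀ i ω, p i ω → ε < M.optValue (s i ω) - M.value (detPolicy (π i ω)) (s i ω)) :
    P.real {ω | ¬ ∀ t, (((Finset.range t).filter fun i => p i ω).card : ℝ) *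
        (ε * (1 - M.γ) / 8) ≤
      M.horizon * (1 + b) + 2 * (M.horizon * (1 + b)) * r' / (1 - M.γ) +
        Fintype.card S * Fintype.card A * ∑ n ∈ Finset.range c,
          sampleCost M.horizon (M.horizon * (1 + b)) (b + d)
            (Fintype.card S * (r / ((1 - M.γ) / 2)) * (M.horizon * (1 + b))) n} ≤
      Fintype.card S * Fintype.card A * c * Real.exp (-(2 * b ^ 2 / M.horizon ^ 2)) +
      Fintype.card S * Fintype.card A * c * Real.exp (-(2 * d ^ 2 / M.horizon ^ 2)) +
      Fintype.card S * Fintype.card A * Fintype.card S * Real.exp (-r) + Real.exp (-r') := by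
  have hH := M.horizon_pos
  have hw := M.one_sub_γ_pos
  have hV0 : 0 < M.horizon * (1 + b) := by positivity
  set K := Fintype.card S * (r / ((1 - M.γ) / 2)) * (M.horizon * (1 + b))
  have hK : 0 ≤ K := by positivity
  -- The deviation bound is one-sided; reflecting V* within [0, H] supplies the lower tail.
  have h1 := h.measureReal_deviation_le (f := fun y => M.horizon - M.optValue y)
    (fun y => sub_nonneg.2 (M.optValue_le_horizon y))
    (fun y => sub_le_self _ (M.optValue_nonneg y)) hb
  have h2 := h.measureReal_deviation_le (f := M.optValue) M.optValue_nonneg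
    M.optValue_le_horizon hd
  have h3 := h.measureReal_frequency_le (θ := (1 - M.γ) / 2) (by linarith)
    (by linarith [M.γ_nonneg]) r
  have h4 := h.measureReal_growth_le hb hε.le K (b + d) r'
  refine le_trans ?_ (add_le_add (add_le_add (add_le_add h1 h2) h3) h4)
  refine le_trans (measureReal_mono ?_) ((measureReal_union_le _ _).trans (add_le_add_left
    ((measureReal_union_le _ _).trans (add_le_add_left (measureReal_union_le _ _) _)) _))
  intro ω hω
  by_contra hgood
  simp only [Set.mem_union, not_or] at hgood
  obtain ⟨⟨⟨g1, g2⟩, g3⟩, g4⟩ := hgood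
  refine hω fun t => ?_
  have hacc : IsAccurate M b d r c (fun i => s i ω) (fun i => a i ω) := by
    refine ⟨fun x u t hn => ?_, fun x u t hn => ?_, fun x u y t => ?_⟩
    · exact not_lt.1 fun hlt => g1 ⟨x, u, t, hn, hlt⟩
    · exact not_lt.1 fun hlt => g2 ⟨x, u, t, hn, hlt⟩
    · exact not_lt.1 fun hlt => g3 ⟨x, u, y, t, hlt⟩
  have hstep := h.excess_le htie hb hd hr hε.le hc hsmall hacc
  have hgrowth : ∀ t, _ < r' := fun t => not_le.1 fun hle => g4 ⟨hstep, t, hle⟩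
  have hopt : ∀ i x, M.optValue x ≤ h.bonusValue i ω x := fun i =>
    (h.isBonusValue i ω).optValue_le hb (fun x u => hacc.lower x u i)
  refine (card_mul_le_of_potential hw (by linarith [M.γ_nonneg]) hV0
    (Y := fun i => excess M ε (h.bonusValue i ω) (π i ω) (s i ω))
    (G := fun i => if sampleCount c (fun i => s i ω) (fun i => a i ω) i (s i ω) (a i ω) < c then
      sampleCost M.horizon (M.horizon * (1 + b)) (b + d) K
        (sampleCount c (fun i => s i ω) (fun i => a i ω) i (s i ω) (a i ω)) else 0)
    (fun i => excess_nonneg M ε _ _ _)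
    (fun i => _root_.excess_le M hε.le hV0.le ((h.isBonusValue i ω).le hb _) _)
    hgrowth (fun i => h.excess_le_succ hb i ω _ rfl)
    (fun i => stepError_add_le _ _ _ _ (sampleCount_le c _ _ _ _ _) hc)
    (fun i => by positivity) (p := fun i => p i ω) (fun i hi => ?_) t).trans ?_
  -- By optimism V - V^π ≥ V* - V^π > ε at a bad step, so the excess there is at least ε/2.
  · have e1 := le_excess_add M ε (h.bonusValue i ω) (π i ω) (s i ω)
    linarith [hp i ω hi, hopt i (s i ω)]
  · gcongr
    refine sum_sampled_le c (fun i => s i ω) (fun i => a i ω) (fun n => ?_) t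
    unfold sampleCost
    split_ifs <;> positivity

end Run

/-! ### Summing the costs and choosing the parameters. -/

section Numerics

/-- Telescoping of 2√n; the term n = 0 vanishes because division by zero yields 0. -/
lemma sum_range_inv_sqrt_le (c : ℕ) : ∑ n ∈ Finset.range c, 1 / Real.sqrt n ≤ 2 * Real.sqrt c := by
  have h : ∀ c : ℕ, ∑ n ∈ Finset.range (c + 1), 1 / Real.sqrt n ≤ 2 * Real.sqrt c := by
    intro c
    induction c with
    | zero => simp
    | succ c ih =>
      rw [Finset.sum_range_succ]
      have h0 : 0 ≤ Real.sqrt c := Real.sqrt_nonneg _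
      have h1 : 0 < Real.sqrt ((c + 1 : ℕ) : ℝ) := Real.sqrt_pos.2 (by positivity)
      have h2 : Real.sqrt c ^ 2 = c := Real.sq_sqrt (by positivity)
      have h3 : Real.sqrt ((c + 1 : ℕ) : ℝ) ^ 2 = c + 1 := by
        rw [Real.sq_sqrt (by positivity)]
        push_cast
        ring
      have h4 : 1 / Real.sqrt ((c + 1 : ℕ) : ℝ) ≤
          2 * Real.sqrt ((c + 1 : ℕ) : ℝ) - 2 * Real.sqrt c := by
        rw [div_le_iff₀ h1]
        nlinarith [sq_nonneg (Real.sqrt ((c + 1 : ℕ) : ℝ) - Real.sqrt c)]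
      linarith
  refine le_trans ?_ (h c)
  rw [Finset.sum_range_succ]
  exact le_add_of_nonneg_right (by positivity)

lemma sum_range_inv_le (c : ℕ) : ∑ n ∈ Finset.range c, 1 / (n : ℝ) ≤ 1 + Real.log c := by
  rcases c with _ | c
  · simp
  · rw [Finset.sum_range_succ']
    have h := harmonic_le_one_add_log c
    rw [harmonic] at h
    push_cast at h
    have h1 : Real.log c ≤ Real.log ((c + 1 : ℕ) : ℝ) := by
      rcases Nat.eq_zero_or_pos c with rfl | hc
      · simp
      · exact Real.log_le_log (by exact_mod_cast hc) (by push_cast; linarith)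
    simp only [one_div, Nat.cast_zero, inv_zero, add_zero]
    push_cast at h1 ⊢
    linarith

lemma sum_sampleCost_le {h Vm e K : ℝ} (hh : 0 ≤ h) (hVm : 0 ≤ Vm) (he : 0 ≤ e) (hK : 0 ≤ K)
    (c : ℕ) : ∑ n ∈ Finset.range c, sampleCost h Vm e K n ≤
      2 * h + Vm + c * h + 2 * e * Real.sqrt c + (K + 2 * h * Vm) * (1 + Real.log c) := by
  have h1 : ∀ n : ℕ, sampleCost h Vm e K n ≤ (if n = 0 then 2 * h + Vm else 0) + h +
      e * (1 / Real.sqrt n) + (K + 2 * h * Vm) * (1 / n) := by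
    intro n
    unfold sampleCost
    split_ifs with h0
    · subst h0
      simp [hh]
    · rw [mul_one_div, mul_one_div, zero_add]
  calc _ ≤ ∑ n ∈ Finset.range c, ((if n = 0 then 2 * h + Vm else 0) + h +
      e * (1 / Real.sqrt n) + (K + 2 * h * Vm) * (1 / n)) := Finset.sum_le_sum fun n _ => h1 n
    _ ≤ _ := by
      rw [Finset.sum_add_distrib, Finset.sum_add_distrib, Finset.sum_add_distrib,
        ← Finset.mul_sum, ← Finset.mul_sum, Finset.sum_const, Finset.card_range, nsmul_eq_mul,
        Finset.sum_ite_eq']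
      have e1 := mul_le_mul_of_nonneg_left (sum_range_inv_sqrt_le c) he
      have e2 := mul_le_mul_of_nonneg_left (sum_range_inv_le c) (a := K + 2 * h * Vm)
        (by positivity)
      have e3 : (if 0 ∈ Finset.range c then 2 * h + Vm else 0) ≤ 2 * h + Vm := by
        split_ifs
        · exact le_rfl
        · positivity
      linarith

/-! ### Parameter inequalities, with `w * H = 1` and `g` in the role of the square root of `max p
1`. -/

section Parameters

variable {S A H w ℓ ε m g c b d r r' : ℝ}

lemma horizon_mul_add_le (hH : 1 ≤ H) (hℓ : 1 ≤ ℓ) (hg : 1 ≤ g) (hb : b ≤ 3 * g * H * ℓ) :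
    H * (1 + b) ≤ 4 * g * H ^ 2 * ℓ := by
  have h1 : 1 ≤ g * H := one_le_mul_of_one_le_of_one_le hg hH
  have h2 : 1 ≤ g * H * ℓ := one_le_mul_of_one_le_of_one_le h1 hℓ
  calc H * (1 + b) ≤ H * (4 * (g * H * ℓ)) := by
        refine mul_le_mul_of_nonneg_left ?_ (by linarith)
        linarith
    _ = _ := by ring

lemma secondOrder_le (hS : 1 ≤ S) (hH : 1 ≤ H) (hwH : w * H = 1) (hℓ : 1 ≤ ℓ) (hg : 1 ≤ g)
    (hb0 : 0 ≤ b) (hb : b ≤ 3 * g * H * ℓ) (hr : r ≤ 3 * ℓ) :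
    S * (r / (w / 2)) * (H * (1 + b)) ≤ 24 * g * S * H ^ 3 * ℓ ^ 2 := by
  have h1 := horizon_mul_add_le hH hℓ hg hb
  have hw : r / (w / 2) = 2 * r * H := by
    have : w ≠ 0 := fun h => by simp [h] at hwH
    field_simp
    linear_combination (-r) * hwH
  rw [hw]
  calc S * (2 * r * H) * (H * (1 + b)) ≤ S * (2 * (3 * ℓ) * H) * (4 * g * H ^ 2 * ℓ) := by
        gcongr
    _ = _ := by ring

/-- The factor g² in the cap compensates the factor g in the bonus. The constant 4000 exceeds 60²,
which makes the first term at most wε/10; the second is at most 3wε/500, and together they stay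
below wε/4. -/
lemma error_at_cap_le (hS : 1 ≤ S) (hH : 1 ≤ H) (hwH : w * H = 1) (hℓ : 1 ≤ ℓ) (hε : 0 < ε)
    (hε1 : ε ≤ 1) (hm : 4000 * (ℓ ^ 2 * (S * H ^ 4 / ε ^ 2)) ≤ m) (hg : 1 ≤ g)
    (hc : g ^ 2 * m ≤ c) (hb0 : 0 ≤ b) (hb : b ≤ 3 * g * H * ℓ) (hd : d ≤ 3 * g * H * ℓ)
    (hr : r ≤ 3 * ℓ) :
    (b + d) / Real.sqrt c + S * (r / (w / 2)) * (H * (1 + b)) / c ≤ w / 2 * (ε / 2) := by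
  have hw : w = 1 / H := by rw [eq_div_iff (by positivity), hwH]
  have hcl : 4000 * (g ^ 2 * (ℓ ^ 2 * (S * H ^ 4 / ε ^ 2))) ≤ c := by
    refine le_trans ?_ hc
    nlinarith [mul_le_mul_of_nonneg_left hm (sq_nonneg g)]
  have hc0 : 0 < c := lt_of_lt_of_le (by positivity) hcl
  have h1 : 60 * (g * ℓ * H ^ 2 / ε) ≤ Real.sqrt c := by
    refine Real.le_sqrt_of_sq_le (le_trans ?_ hcl)
    have : (60 * (g * ℓ * H ^ 2 / ε)) ^ 2 = 3600 * (g ^ 2 * (ℓ ^ 2 * (1 * H ^ 4 / ε ^ 2))) := by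
      ring
    rw [this]
    gcongr
    norm_num
  have h2 : (b + d) / Real.sqrt c ≤ (6 * g * H * ℓ) / (60 * (g * ℓ * H ^ 2 / ε)) := by
    refine div_le_div₀ (by positivity) (by linarith) (by positivity) h1
  have h3 : (6 * g * H * ℓ) / (60 * (g * ℓ * H ^ 2 / ε)) = w * ε / 10 := by
    rw [hw]
    field_simp
    norm_num
  have h4 : S * (r / (w / 2)) * (H * (1 + b)) / c ≤
      24 * g * S * H ^ 3 * ℓ ^ 2 / (4000 * (g ^ 2 * (ℓ ^ 2 * (S * H ^ 4 / ε ^ 2)))) :=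
    div_le_div₀ (by positivity) (secondOrder_le hS hH hwH hℓ hg hb0 hb hr) (by positivity) hcl
  have h5 : 24 * g * S * H ^ 3 * ℓ ^ 2 / (4000 * (g ^ 2 * (ℓ ^ 2 * (S * H ^ 4 / ε ^ 2)))) =
      3 / 500 * (w * ε) * (ε / g) := by
    rw [hw]
    field_simp
    norm_num
  have h6 : ε / g ≤ 1 := div_le_one_of_le₀ (hε1.trans hg) (by linarith)
  have hwε : 0 ≤ w * ε := by rw [hw]; positivity
  nlinarith

/-- Every term is compared with U = g² m H ℓ, the cost of one horizon for each sample of a pair,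
times ℓ. The second-order term of order S H³ ℓ² fits because `m` already contains a factor S. The
constants add up to 4 + 24 + (2 + 4 + 2 + 24 + 480) = 540. -/
lemma total_cost_le (hS : 1 ≤ S) (hA : 1 ≤ A) (hH : 1 ≤ H) (hwH : w * H = 1) (hℓ : 1 ≤ ℓ)
    (hm : ℓ ^ 2 * (S * H ^ 4) ≤ m) (hg : 1 ≤ g)
    (hc0 : 0 < c) (hc : c ≤ 2 * g ^ 2 * m) (hb0 : 0 ≤ b) (hb : b ≤ 3 * g * H * ℓ)
    (hd : d ≤ 3 * g * H * ℓ) (hr0 : 0 ≤ r) (hr : r ≤ 3 * ℓ) (hr' : r' ≤ 3 * ℓ)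
    (hlog : Real.log (2 * m) ≤ 12 * ℓ) :
    H * (1 + b) + 2 * (H * (1 + b)) * r' / w + S * A * (2 * H + H * (1 + b) + c * H +
      2 * (b + d) * Real.sqrt c + (S * (r / (w / 2)) * (H * (1 + b)) +
        2 * H * (H * (1 + b))) * (1 + Real.log c)) ≤ 540 * (S * A * (g ^ 2 * m * H * ℓ)) := by
  have hw : ∀ z, z / w = z * H := fun z => by
    have : w ≠ 0 := fun h => by simp [h] at hwH
    rw [div_eq_iff this, mul_assoc, mul_comm H, hwH, mul_one]
  have hV := horizon_mul_add_le hH hℓ hg hb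
  have hV0 : 0 ≤ H * (1 + b) := by positivity
  have hK := secondOrder_le hS hH hwH hℓ hg hb0 hb hr
  set V := H * (1 + b)
  set K := S * (r / (w / 2)) * V
  set U := g ^ 2 * m * H * ℓ with hU
  have hHS : ∀ i j : ℕ, i ≤ 4 → j ≤ 2 → H ^ i * ℓ ^ j ≤ m := by
    intro i j hi hj
    refine le_trans ?_ hm
    calc H ^ i * ℓ ^ j ≤ H ^ 4 * ℓ ^ 2 :=
          mul_le_mul (pow_le_pow_right₀ hH hi) (pow_le_pow_right₀ hℓ hj) (by positivity)
            (by positivity)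
      _ = ℓ ^ 2 * (1 * H ^ 4) := by ring
      _ ≤ _ := by gcongr
  have hm1 : 1 ≤ m := by simpa using hHS 0 0 (by norm_num) (by norm_num)
  have hgg : g ≤ g ^ 2 := by nlinarith
  have u1 : g * (H * m) ≤ U := by
    calc g * (H * m) = g * m * H * 1 := by ring
      _ ≤ U := by rw [hU]; gcongr
  have hV1 : V ≤ 4 * U := by
    calc V ≤ 4 * g * H ^ 2 * ℓ := hV
      _ = 4 * (g * (H * (H ^ 1 * ℓ ^ 1))) := by ring
      _ ≤ 4 * (g * (H * m)) := by gcongr; exact hHS 1 1 (by norm_num) (by norm_num)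
      _ ≤ 4 * U := by gcongr
  have hV2 : 2 * V * r' / w ≤ 24 * U := by
    rw [hw]
    calc 2 * V * r' * H ≤ 2 * (4 * g * H ^ 2 * ℓ) * (3 * ℓ) * H := by
          refine mul_le_mul_of_nonneg_right ?_ (by linarith)
          refine (mul_le_mul_of_nonneg_left hr' (by positivity)).trans ?_
          gcongr
      _ = 24 * (g * (H * (H ^ 2 * ℓ ^ 2))) := by ring
      _ ≤ 24 * (g * (H * m)) := by gcongr; exact hHS 2 2 (by norm_num) (by norm_num)
      _ ≤ 24 * U := by gcongr
  have hH1 : 2 * H ≤ 2 * U := by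
    calc 2 * H = 2 * (1 * (H * 1)) := by ring
      _ ≤ 2 * (g * (H * m)) := by gcongr
      _ ≤ 2 * U := by gcongr
  have hcH : c * H ≤ 2 * U := by
    calc c * H ≤ 2 * g ^ 2 * m * H := by gcongr
      _ = 2 * (g ^ 2 * m * H * 1) := by ring
      _ ≤ 2 * U := by rw [hU]; gcongr
  have hsq : Real.sqrt c ≤ 2 * (g * m) := by
    refine Real.sqrt_le_iff.2 ⟨by positivity, hc.trans ?_⟩
    nlinarith [sq_nonneg g, mul_le_mul_of_nonneg_left hm1 (by positivity : 0 ≤ g ^ 2 * m)]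
  have hbd : 2 * (b + d) * Real.sqrt c ≤ 24 * U := by
    calc 2 * (b + d) * Real.sqrt c ≤ 2 * (3 * g * H * ℓ + 3 * g * H * ℓ) * (2 * (g * m)) := by
          gcongr
      _ = 24 * U := by rw [hU]; ring
  have hlc : 1 + Real.log c ≤ 15 * (g * ℓ) := by
    have e1 : Real.log c ≤ Real.log (2 * m) + 2 * Real.log g := by
      rw [← Real.log_rpow (by positivity), ← Real.log_mul (by positivity) (by positivity)]
      refine Real.log_le_log hc0 (hc.trans (le_of_eq ?_))
      norm_num
      ring
    have e2 : Real.log g ≤ g := (Real.log_le_sub_one_of_pos (by positivity)).trans (by linarith)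
    nlinarith
  have hKV : K + 2 * H * V ≤ 32 * (g * (m * H)) := by
    calc K + 2 * H * V ≤ 24 * g * S * H ^ 3 * ℓ ^ 2 + 2 * H * (4 * g * H ^ 2 * ℓ) := by gcongr
      _ = 24 * g * S * H ^ 3 * ℓ ^ 2 + 8 * g * 1 * H ^ 3 * (ℓ * 1) := by ring
      _ ≤ 24 * g * S * H ^ 3 * ℓ ^ 2 + 8 * g * S * H ^ 3 * (ℓ * ℓ) := by gcongr
      _ = 32 * (g * (ℓ ^ 2 * (S * H ^ 2) * H)) := by ring
      _ ≤ 32 * (g * (ℓ ^ 2 * (S * H ^ 4) * H)) := by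
          gcongr
          norm_num
      _ ≤ 32 * (g * (m * H)) := by gcongr
  have hKV0 : 0 ≤ K + 2 * H * V := by
    have : 0 ≤ r / (w / 2) := by
      have : 0 ≤ w := by
        by_contra! hneg
        nlinarith
      positivity
    positivity
  have hprod : (K + 2 * H * V) * (1 + Real.log c) ≤ 480 * U := by
    calc (K + 2 * H * V) * (1 + Real.log c) ≤ (K + 2 * H * V) * (15 * (g * ℓ)) := by gcongr
      _ ≤ 32 * (g * (m * H)) * (15 * (g * ℓ)) := by gcongr
      _ = 480 * U := by rw [hU]; ring
  have hSA : 1 ≤ S * A := one_le_mul_of_one_le_of_one_le hS hA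
  have hU0 : 0 ≤ U := by positivity
  have hin : S * A * (2 * H + V + c * H + 2 * (b + d) * Real.sqrt c +
      (K + 2 * H * V) * (1 + Real.log c)) ≤ S * A * (512 * U) := by
    refine mul_le_mul_of_nonneg_left ?_ (by linarith)
    linarith
  nlinarith

end Parameters

end Numerics

/-! ### The sample cap and its logarithms. -/

section SampleCap

/-- The sample cap of MBIE-EB. -/
def sampleCap (nS nA : ℕ) (ε δ γ : ℝ) : ℕ :=
  ⌈4000 * (logFactor nS nA ε δ γ ^ 2 * (nS / (ε ^ 2 * (1 - γ) ^ 4)))⌉₊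

/-- The range of the parameters. -/
structure IsAdmissible (nS nA : ℕ) (ε δ γ : ℝ) : Prop where
  one_le_nS : 1 ≤ nS
  one_le_nA : 1 ≤ nA
  ε_pos : 0 < ε
  ε_le_one : ε ≤ 1
  δ_pos : 0 < δ
  δ_lt_one : δ < 1
  γ_nonneg : 0 ≤ γ
  γ_lt_one : γ < 1

namespace IsAdmissible

variable {nS nA : ℕ} {ε δ γ : ℝ}

lemma one_le_nS' (h : IsAdmissible nS nA ε δ γ) : (1 : ℝ) ≤ nS := Nat.one_le_cast.2 h.one_le_nS

lemma one_le_nA' (h : IsAdmissible nS nA ε δ γ) : (1 : ℝ) ≤ nA := Nat.one_le_cast.2 h.one_le_nA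

lemma one_sub_pos (h : IsAdmissible nS nA ε δ γ) : 0 < 1 - γ := sub_pos.2 h.γ_lt_one

lemma one_le_inv (h : IsAdmissible nS nA ε δ γ) : 1 ≤ (1 - γ)⁻¹ :=
  (one_le_inv₀ h.one_sub_pos).2 (by linarith [h.γ_nonneg])

/-- Monomials in the parameters are bounded by powers of the argument of the logarithm. -/
lemma monomial_le (h : IsAdmissible nS nA ε δ γ) (i j k l n N : ℕ) (hi : i ≤ N) (hj : j ≤ N)
    (hk : k ≤ N) (hl : l ≤ N) (hn : n ≤ N) :
    (nS : ℝ) ^ i * nA ^ j * ε⁻¹ ^ k * δ⁻¹ ^ l * (1 - γ)⁻¹ ^ n ≤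
      (nS * nA / (ε * δ * (1 - γ))) ^ N := by
  have h1 := h.one_le_nS'
  have h2 := h.one_le_nA'
  have h3 : 1 ≤ ε⁻¹ := (one_le_inv₀ h.ε_pos).2 h.ε_le_one
  have h4 : 1 ≤ δ⁻¹ := (one_le_inv₀ h.δ_pos).2 h.δ_lt_one.le
  have h5 := h.one_le_inv
  have h6 : (nS * nA / (ε * δ * (1 - γ))) ^ N =
      (nS : ℝ) ^ N * nA ^ N * ε⁻¹ ^ N * δ⁻¹ ^ N * (1 - γ)⁻¹ ^ N := by
    rw [← mul_pow, ← mul_pow, ← mul_pow, ← mul_pow]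
    congr 1
    rw [div_eq_mul_inv, mul_inv, mul_inv]
    ring
  rw [h6]
  gcongr

lemma one_le_argument (h : IsAdmissible nS nA ε δ γ) :
    1 ≤ (nS * nA / (ε * δ * (1 - γ)) : ℝ) := by
  have := h.monomial_le 0 0 0 0 0 1 (by simp) (by simp) (by simp) (by simp) (by simp)
  simpa using this

lemma logFactor_eq (h : IsAdmissible nS nA ε δ γ) :
    logFactor nS nA ε δ γ = 1 + Real.log (nS * nA / (ε * δ * (1 - γ))) := by
  have h1 := h.one_le_argument
  rw [logFactor, mul_assoc, mul_div_assoc, Real.log_mul (Real.exp_pos 1).ne' (by positivity),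
    Real.log_exp]

lemma one_le_logFactor (h : IsAdmissible nS nA ε δ γ) : 1 ≤ logFactor nS nA ε δ γ := by
  rw [h.logFactor_eq]
  linarith [Real.log_nonneg h.one_le_argument]

lemma logFactor_le (h : IsAdmissible nS nA ε δ γ) :
    logFactor nS nA ε δ γ ≤ nS * nA / (ε * δ * (1 - γ)) := by
  rw [h.logFactor_eq]
  linarith [Real.log_le_sub_one_of_pos (zero_lt_one.trans_le h.one_le_argument)]

lemma one_le_main (h : IsAdmissible nS nA ε δ γ) :
    1 ≤ logFactor nS nA ε δ γ ^ 2 * (nS / (ε ^ 2 * (1 - γ) ^ 4)) := by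
  have h1 : 1 ≤ logFactor nS nA ε δ γ ^ 2 := one_le_pow₀ h.one_le_logFactor
  have h2 : (1 : ℝ) ≤ nS / (ε ^ 2 * (1 - γ) ^ 4) := by
    have hw := h.one_sub_pos
    have hε := h.ε_pos
    rw [le_div_iff₀ (by positivity), one_mul]
    refine le_trans ?_ h.one_le_nS'
    exact mul_le_one₀ (pow_le_one₀ h.ε_pos.le h.ε_le_one) (by positivity)
      (pow_le_one₀ hw.le (by linarith [h.γ_nonneg]))
  exact one_le_mul_of_one_le_of_one_le h1 h2

lemma le_sampleCap (nS nA : ℕ) (ε δ γ : ℝ) :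
    4000 * (logFactor nS nA ε δ γ ^ 2 * (nS / (ε ^ 2 * (1 - γ) ^ 4))) ≤
      sampleCap nS nA ε δ γ := Nat.le_ceil _

lemma sampleCap_le (h : IsAdmissible nS nA ε δ γ) :
    (sampleCap nS nA ε δ γ : ℝ) ≤
      4001 * (logFactor nS nA ε δ γ ^ 2 * (nS / (ε ^ 2 * (1 - γ) ^ 4))) := by
  have h1 := h.one_le_main
  have h2 := (Nat.ceil_lt_add_one (a := 4000 * (logFactor nS nA ε δ γ ^ 2 *
    (nS / (ε ^ 2 * (1 - γ) ^ 4)))) (by positivity)).le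
  rw [sampleCap]
  linarith

lemma sampleCap_ge (h : IsAdmissible nS nA ε δ γ) : (4000 : ℝ) ≤ sampleCap nS nA ε δ γ := by
  linarith [le_sampleCap nS nA ε δ γ, h.one_le_main]

/-- With ℓ ≤ X, where ℓ = 1 + log X, the argument is at most 64016 X⁷ ≤ e¹² X⁷, and 12 + 7 log X ≤
12 ℓ. -/
lemma log_sampleCap_le (h : IsAdmissible nS nA ε δ γ) :
    Real.log (16 * nS * nA * sampleCap nS nA ε δ γ / δ) ≤ 12 * logFactor nS nA ε δ γ := by
  set X : ℝ := nS * nA / (ε * δ * (1 - γ))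
  have hX1 : 1 ≤ X := h.one_le_argument
  have hw := h.one_sub_pos
  have hε := h.ε_pos
  have hδ := h.δ_pos
  have h1 := h.one_le_nS'
  have h2 := h.one_le_nA'
  have hm := h.sampleCap_ge
  have hmono := h.monomial_le 2 1 2 1 4 5 (by norm_num) (by norm_num) (by norm_num)
    (by norm_num) (by norm_num)
  have hsq : logFactor nS nA ε δ γ ^ 2 ≤ X ^ 2 :=
    pow_le_pow_left₀ (zero_le_one.trans h.one_le_logFactor) h.logFactor_le 2
  have hle : 16 * nS * nA * sampleCap nS nA ε δ γ / δ ≤ Real.exp 12 * X ^ 7 := by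
    calc 16 * nS * nA * sampleCap nS nA ε δ γ / δ
        ≤ 16 * nS * nA * (4001 * (X ^ 2 * (nS / (ε ^ 2 * (1 - γ) ^ 4)))) / δ := by
          have := h.sampleCap_le
          gcongr
          exact this.trans (by gcongr)
      _ = 64016 * (X ^ 2 * ((nS : ℝ) ^ 2 * nA ^ 1 * ε⁻¹ ^ 2 * δ⁻¹ ^ 1 * (1 - γ)⁻¹ ^ 4)) := by
          field_simp
          norm_num
      _ ≤ 64016 * (X ^ 2 * X ^ 5) := by gcongr
      _ = 64016 * X ^ 7 := by ring
      _ ≤ Real.exp 12 * X ^ 7 := by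
          gcongr
          have e1 : Real.exp 12 = Real.exp 1 ^ 12 := by rw [← Real.exp_nat_mul]; norm_num
          have e2 : (2.7 : ℝ) ≤ Real.exp 1 := by linarith [Real.exp_one_gt_d9]
          rw [e1]
          exact le_trans (by norm_num) (pow_le_pow_left₀ (by norm_num) e2 12)
  refine (Real.log_le_log (by positivity) hle).trans ?_
  rw [Real.log_mul (Real.exp_pos _).ne' (by positivity), Real.log_exp, Real.log_pow,
    h.logFactor_eq]
  have := Real.log_nonneg hX1
  push_cast
  linarith

lemma log_sixteen_le : Real.log 16 ≤ 3 := by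
  rw [Real.log_le_iff_le_exp (by norm_num)]
  have e1 : Real.exp 3 = Real.exp 1 ^ 3 := by rw [← Real.exp_nat_mul]; norm_num
  have e2 : (2.7 : ℝ) ≤ Real.exp 1 := by linarith [Real.exp_one_gt_d9]
  rw [e1]
  exact le_trans (by norm_num) (pow_le_pow_left₀ (by norm_num) e2 3)

lemma log_sq_le (h : IsAdmissible nS nA ε δ γ) :
    Real.log (16 * nS ^ 2 * nA / δ) ≤ 3 * logFactor nS nA ε δ γ := by
  set X : ℝ := nS * nA / (ε * δ * (1 - γ))
  have hX1 : 1 ≤ X := h.one_le_argument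
  have hδ := h.δ_pos
  have h1 := h.one_le_nS'
  have h2 := h.one_le_nA'
  have hmono := h.monomial_le 2 1 0 1 0 2 (by norm_num) (by norm_num) (by norm_num)
    (by norm_num) (by norm_num)
  have hle : 16 * nS ^ 2 * nA / δ ≤ 16 * X ^ 2 := by
    refine le_trans (le_of_eq ?_) (mul_le_mul_of_nonneg_left hmono (by norm_num))
    simp
    ring
  refine (Real.log_le_log (by positivity) hle).trans ?_
  rw [Real.log_mul (by norm_num) (by positivity), Real.log_pow, h.logFactor_eq]
  have := Real.log_nonneg hX1
  have := log_sixteen_le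
  push_cast
  linarith

end IsAdmissible

/-- Exponential decay of the failure probability in the exploration factor. -/
lemma exp_neg_mul_log_le {N p : ℝ} (hN : Real.exp 1 ≤ N) (hp : 1 ≤ p) :
    Real.exp (-(p * Real.log N)) ≤ 1 / (p * N) := by
  have hN0 : 0 < N := (Real.exp_pos 1).trans_le hN
  have hlog : 1 ≤ Real.log N := (Real.le_log_iff_exp_le hN0).2 hN
  rw [Real.exp_neg, ← one_div]
  refine one_div_le_one_div_of_le (by positivity) ?_
  have h1 : Real.exp (p * Real.log N) = Real.exp ((p - 1) * Real.log N) * N := by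
    rw [sub_mul, one_mul, Real.exp_sub, Real.exp_log hN0]
    field_simp
  rw [h1]
  refine mul_le_mul_of_nonneg_right ?_ hN0.le
  -- Since log N ≥ 1, this gives N^(p-1) ≥ 1 + (p - 1) = p. The factor 1/p gained in this way
  -- offsets the growth of the cap with p.
  have := Real.add_one_le_exp ((p - 1) * Real.log N)
  nlinarith

end SampleCap

/-! ### From finite windows to all times. -/

section AllButAtMost

lemma allButAtMost_of_card_le {T : ℝ} {Q : ℕ → Prop} [DecidablePred Q]
    (h : ∀ t, (((Finset.range t).filter fun i => ¬ Q i).card : ℝ) ≤ T) : AllButAtMost T Q := by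
  have key : ∀ F : Finset ℕ, (∀ i ∈ F, ¬ Q i) → (F.card : ℝ) ≤ T := by
    intro F hF
    refine le_trans (Nat.cast_le.2 (Finset.card_le_card fun i hi => ?_)) (h (F.sup id + 1))
    exact Finset.mem_filter.2 ⟨Finset.mem_range.2 (Nat.lt_succ_of_le (Finset.le_sup (f := id) hi)),
      hF i hi⟩
  have hfin : {t | ¬ Q t}.Finite := by
    by_contra hinf
    -- An infinite exceptional set would contain a finite subset with more than `T` elements.
    obtain ⟨F, hF, hcard⟩ := Set.Infinite.exists_subset_card_eq hinf (⌊T⌋₊ + 1)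
    have := key F fun i hi => hF hi
    rw [hcard] at this
    push_cast at this
    linarith [Nat.lt_floor_add_one T]
  refine ⟨hfin, ?_⟩
  rw [Set.ncard_eq_toFinset_card _ hfin]
  exact key _ fun i hi => by simpa using hi

end AllButAtMost

/-! ### Failure probabilities and the bound for MBIE-EB. -/

section SampleComplexity

open MeasureTheory

variable {nS nA : ℕ} {ε δ γ : ℝ}

lemma IsAdmissible.exp_one_le (h : IsAdmissible nS nA ε δ γ) :
    Real.exp 1 ≤ 2 * nS * nA * sampleCap nS nA ε δ γ / δ := by
  have h1 := h.one_le_nS'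
  have h2 := h.one_le_nA'
  have h3 := h.sampleCap_ge
  have h4 : (1 : ℝ) ≤ nS * nA := one_le_mul_of_one_le_of_one_le h1 h2
  rw [le_div_iff₀ h.δ_pos]
  have h5 : Real.exp 1 * δ ≤ 3 * 1 :=
    mul_le_mul (by linarith [Real.exp_one_lt_d9]) h.δ_lt_one.le h.δ_pos.le (by norm_num)
  nlinarith

/-- A bonus with exploration factor `p` and confidence parameter `N`. -/
lemma bonus_sq {p N H : ℝ} (hp : 0 ≤ p) (hN : 1 ≤ N) (hH : 0 < H) :
    2 * (Real.sqrt p * (H * Real.sqrt (Real.log N / 2))) ^ 2 / H ^ 2 = p * Real.log N := by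
  rw [mul_pow, mul_pow, Real.sq_sqrt hp, Real.sq_sqrt (by linarith [Real.log_nonneg hN])]
  field_simp

lemma bonus_le {p p' N H ℓ : ℝ} (hpp : p ≤ p') (hH : 0 < H) (hℓ : 1 ≤ ℓ)
    (hN : Real.log N ≤ 12 * ℓ) :
    Real.sqrt p * (H * Real.sqrt (Real.log N / 2)) ≤ 3 * Real.sqrt p' * H * ℓ := by
  have h1 : Real.sqrt (Real.log N / 2) ≤ 3 * ℓ := by
    refine Real.sqrt_le_iff.2 ⟨by linarith, ?_⟩
    nlinarith
  calc Real.sqrt p * (H * Real.sqrt (Real.log N / 2)) ≤ Real.sqrt p' * (H * (3 * ℓ)) := by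
        gcongr
    _ = _ := by ring

/-- The failure probability that is not due to missing optimism. -/
lemma IsAdmissible.failure_le (h : IsAdmissible nS nA ε δ γ) {p c : ℝ} (hp : 1 ≤ p)
    (hc : c ≤ 2 * p * sampleCap nS nA ε δ γ) :
    nS * nA * c * Real.exp (-(p * Real.log (16 * nS * nA * sampleCap nS nA ε δ γ / δ))) +
      nS * nA * nS * Real.exp (-Real.log (16 * nS ^ 2 * nA / δ)) +
      Real.exp (-Real.log (16 / δ)) ≤ δ / 4 := by
  have h1 := h.one_le_nS'
  have h2 := h.one_le_nA'
  have h3 := h.sampleCap_ge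
  have hδ := h.δ_pos
  have hN : Real.exp 1 ≤ 16 * nS * nA * sampleCap nS nA ε δ γ / δ :=
    h.exp_one_le.trans (by gcongr; norm_num)
  set m : ℝ := ((sampleCap nS nA ε δ γ : ℕ) : ℝ)
  have e1 : nS * nA * c * Real.exp (-(p * Real.log (16 * nS * nA * m / δ))) ≤ δ / 8 := by
    calc nS * nA * c * Real.exp (-(p * Real.log (16 * nS * nA * m / δ)))
        ≤ nS * nA * (2 * p * m) * (1 / (p * (16 * nS * nA * m / δ))) := by
          have := exp_neg_mul_log_le hN hp
          gcongr
      _ = δ / 8 := by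
          field_simp
          norm_num
  have e2 : nS * nA * nS * Real.exp (-Real.log (16 * nS ^ 2 * nA / δ)) = δ / 16 := by
    rw [Real.exp_neg, Real.exp_log (by positivity)]
    field_simp
  have e3 : Real.exp (-Real.log (16 / δ)) = δ / 16 := by
    rw [Real.exp_neg, Real.exp_log (by positivity), inv_div]
  linarith

/-- The failure probability due to missing optimism. -/
lemma IsAdmissible.optimism_failure_le (h : IsAdmissible nS nA ε δ γ) {p : ℝ} (hp : 1 ≤ p) :
    nS * nA * ⌈p * sampleCap nS nA ε δ γ⌉₊ *
      (δ / (2 * nS * nA * sampleCap nS nA ε δ γ)) ^ p ≤ 3 * δ / 4 := by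
  have h1 := h.one_le_nS'
  have h2 := h.one_le_nA'
  have h3 := h.sampleCap_ge
  have hδ := h.δ_pos
  have hN := h.exp_one_le
  have hceil := (Nat.ceil_lt_add_one (a := p * sampleCap nS nA ε δ γ) (by positivity)).le
  set m : ℝ := ((sampleCap nS nA ε δ γ : ℕ) : ℝ)
  -- Rounding then costs at most a factor 3/2: ⌈p m⌉ ≤ p m + 1 ≤ (3/2) p m. This leaves δ/4 for the
  -- other failure events.
  have h4 : 2 ≤ p * m := by nlinarith
  have e1 : (δ / (2 * nS * nA * m)) ^ p = Real.exp (-(p * Real.log (2 * nS * nA * m / δ))) := by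
    rw [Real.rpow_def_of_pos (by positivity), ← inv_div, Real.log_inv]
    congr 1
    ring
  rw [e1]
  calc (nS * nA * ⌈p * m⌉₊ : ℝ) * Real.exp (-(p * Real.log (2 * nS * nA * m / δ)))
      ≤ nS * nA * (3 / 2 * (p * m)) * (1 / (p * (2 * nS * nA * m / δ))) := by
        have := exp_neg_mul_log_le hN hp
        gcongr
        linarith
    _ = 3 * δ / 4 := by
        field_simp
        norm_num

variable {S A Ω : Type*} [Fintype S] [Fintype A] [DecidableEq S] [DecidableEq A]
  [MeasurableSpace Ω] {P : Measure Ω} [IsProbabilityMeasure P] {M : MDP S A}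
  {tie : S → (A → ℝ) → A} {s : ℕ → Ω → S} {a : ℕ → Ω → A} {π : ℕ → Ω → S → A}

/-- Sample complexity of MBIE-EB with exploration factor `p`. -/
theorem IsMBIEEBRun.measureReal_allButAtMost_ge {p : ℝ} (hp : 0 < p)
    (hadm : IsAdmissible nS nA ε δ M.γ) {c : ℕ}
    (hc : c = ⌈max p 1 * sampleCap nS nA ε δ M.γ⌉₊) (hnS : Fintype.card S = nS) (hnA : Fintype.card A = nA)
    (h : IsMBIEEBRun P M (Real.sqrt p * mbieBeta nS nA (sampleCap nS nA ε δ M.γ) δ M.γ)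
      c tie s a π)
    (htie : IsGreedyRule tie) {Q : ℕ → Ω → Prop}
    (hQ : ∀ t ω, M.optValue (s t ω) - M.value (detPolicy (π t ω)) (s t ω) ≤ ε → Q t ω) :
    1 - δ / 4 - nS * nA * c *
        (δ / (2 * nS * nA * sampleCap nS nA ε δ M.γ)) ^ p ≤
      P.real {ω | AllButAtMost (max p 1 * (17284320 * logFactor nS nA ε δ M.γ ^ 3 *
        (nS ^ 2 * nA / (ε ^ 3 * (1 - M.γ) ^ 6)))) fun t => Q t ω} := by
  classical
  have : Nonempty A := Fintype.card_pos_iff.1 (hnA ▸ hadm.one_le_nA)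
  have h1 := hadm.one_le_nS'
  have h2 := hadm.one_le_nA'
  have h3 := hadm.sampleCap_ge
  have hδ := hadm.δ_pos
  have hε := hadm.ε_pos
  have hw := hadm.one_sub_pos
  have hN := hadm.exp_one_le
  have hℓ := hadm.one_le_logFactor
  have hH := M.one_le_horizon
  have hwH := M.one_sub_γ_mul_horizon
  have hp1 : 1 ≤ max p 1 := le_max_right _ _
  have hmain : 4000 * (logFactor nS nA ε δ M.γ ^ 2 * (nS * M.horizon ^ 4 / ε ^ 2)) ≤
      sampleCap nS nA ε δ M.γ := by
    refine le_trans (le_of_eq ?_) (IsAdmissible.le_sampleCap nS nA ε δ M.γ)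
    rw [MDP.horizon]
    field_simp
  have hcap := hadm.sampleCap_le
  have hlog := hadm.log_sampleCap_le
  have hcm : max p 1 * sampleCap nS nA ε δ M.γ ≤ c := hc ▸ Nat.le_ceil _
  have hcm' : (c : ℝ) ≤ 2 * max p 1 * sampleCap nS nA ε δ M.γ := by
    rw [hc]
    have := (Nat.ceil_lt_add_one (a := max p 1 * sampleCap nS nA ε δ M.γ) (by positivity)).le
    nlinarith
  have hfail := hadm.failure_le hp1 hcm'
  set m := sampleCap nS nA ε δ M.γ
  set ℓ := logFactor nS nA ε δ M.γ
  have hc0 : (0 : ℝ) < c := lt_of_lt_of_le (by positivity) hcm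
  have hg : 1 ≤ Real.sqrt (max p 1) := Real.one_le_sqrt.2 hp1
  have hg2 : Real.sqrt (max p 1) ^ 2 = max p 1 := Real.sq_sqrt (by linarith)
  have hN1 : (1 : ℝ) ≤ 2 * nS * nA * m / δ := (Real.one_le_exp zero_le_one).trans hN
  have hNN : (2 * nS * nA * m / δ : ℝ) ≤ 16 * nS * nA * m / δ := by
    gcongr
    norm_num
  have hb : Real.sqrt p * mbieBeta nS nA m δ M.γ ≤
      3 * Real.sqrt (max p 1) * M.horizon * ℓ :=
    bonus_le (le_max_left p 1) M.horizon_pos hℓ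
      ((Real.log_le_log (by linarith) hNN).trans hlog)
  have hb0 : 0 ≤ Real.sqrt p * mbieBeta nS nA m δ M.γ := by
    unfold mbieBeta
    positivity
  -- This width belongs to the analysis, not to the algorithm. Using 16 instead of 2 in the
  -- logarithm, and `max p 1` instead of `p`, keeps its failure probability below δ/8 for every p.
  set d := Real.sqrt (max p 1) *
    (M.horizon * Real.sqrt (Real.log (16 * nS * nA * m / δ) / 2))
  have hd : d ≤ 3 * Real.sqrt (max p 1) * M.horizon * ℓ :=
    bonus_le le_rfl M.horizon_pos hℓ hlog
  have hd0 : 0 ≤ d := by positivity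
  have hr : Real.log (16 * nS ^ 2 * nA / δ) ≤ 3 * ℓ := hadm.log_sq_le
  have hr0 : 0 ≤ Real.log (16 * nS ^ 2 * nA / δ) := by
    refine Real.log_nonneg ?_
    rw [le_div_iff₀ hδ]
    have := one_le_mul_of_one_le_of_one_le (one_le_pow₀ h1 (n := 2)) h2
    linarith [hadm.δ_lt_one]
  have hr' : Real.log (16 / δ) ≤ 3 * ℓ := by
    refine le_trans (Real.log_le_log (by positivity) ?_) hr
    gcongr
    have := one_le_mul_of_one_le_of_one_le (one_le_pow₀ h1 (n := 2)) h2
    linarith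
  have hsmall := error_at_cap_le h1 hH hwH hℓ hε hadm.ε_le_one hmain hg (hg2 ▸ hcm) hb0 hb hd hr
  have htotal := total_cost_le h1 h2 hH hwH hℓ (m := m) ?_ hg hc0 (by rwa [hg2]) hb0 hb hd
    hr0 hr hr' ?_
  · have hrun := h.measureReal_card_suboptimal_le htie (r' := Real.log (16 / δ)) hb0 hd0 hr0 hε
      (Nat.cast_pos.1 hc0) (by rw [hnS]; exact hsmall) (fun i ω => ¬ Q i ω)
      fun i ω hi => not_le.1 fun hle => hi (hQ i ω hle)
    rw [hnS, hnA] at hrun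
    have e1 : Real.exp (-(2 * (Real.sqrt p * mbieBeta nS nA m δ M.γ) ^ 2 / M.horizon ^ 2)) =
        (δ / (2 * nS * nA * m)) ^ p := by
      have := bonus_sq hp.le hN1 M.horizon_pos
      rw [mbieBeta, ← MDP.horizon, this, Real.rpow_def_of_pos (by positivity), ← inv_div,
        Real.log_inv]
      congr 1
      ring
    have e2 : 2 * d ^ 2 / M.horizon ^ 2 = max p 1 * Real.log (16 * nS * nA * m / δ) :=
      bonus_sq (by linarith) (hN1.trans hNN) M.horizon_pos
    rw [e1, e2] at hrun
    -- Subadditivity alone gives this inequality, so the success event need not be shown measurable.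
    have hcompl : ∀ E : Set Ω, 1 ≤ P.real E + P.real Eᶜ := fun E => by
      have := measureReal_union_le (μ := P) E Eᶜ
      rwa [Set.union_compl_self, probReal_univ] at this
    refine le_trans ?_ (sub_le_iff_le_add.2 (hcompl _))
    refine le_trans ?_ (sub_le_sub_left ((measureReal_mono ?_).trans hrun) 1)
    · linarith
    · refine fun ω hω hcard => hω (allButAtMost_of_card_le fun t => ?_)
      have hcost := sum_sampleCost_le (h := M.horizon)
        (Vm := M.horizon * (1 + Real.sqrt p * mbieBeta nS nA m δ M.γ))
        (e := Real.sqrt p * mbieBeta nS nA m δ M.γ + d)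
        (K := nS * (Real.log (16 * nS ^ 2 * nA / δ) / ((1 - M.γ) / 2)) *
          (M.horizon * (1 + Real.sqrt p * mbieBeta nS nA m δ M.γ)))
        (by linarith) (by positivity) (by linarith) (by positivity) c
      have hcard' := (hcard t).trans ((add_le_add_right
        (mul_le_mul_of_nonneg_left hcost (by positivity)) _).trans htotal)
      rw [hg2, ← le_div_iff₀ (by positivity)] at hcard'
      refine hcard'.trans ?_
      calc _ ≤ 540 * (nS * nA * (max p 1 * (4001 * (ℓ ^ 2 * (nS / (ε ^ 2 * (1 - M.γ) ^ 4)))) *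
            M.horizon * ℓ)) / (ε * (1 - M.γ) / 8) := by gcongr
        _ = _ := by
          rw [MDP.horizon]
          field_simp
          norm_num
  · refine le_trans ?_ hmain
    have e1 : (nS * M.horizon ^ 4 : ℝ) ≤ nS * M.horizon ^ 4 / ε ^ 2 := by
      refine le_div_self (by positivity) (by positivity) ?_
      exact pow_le_one₀ hε.le hadm.ε_le_one
    have e2 := mul_le_mul_of_nonneg_left e1 (sq_nonneg ℓ)
    have : 0 ≤ ℓ ^ 2 * (nS * M.horizon ^ 4 / ε ^ 2) := by positivity
    linarith
  · refine (Real.log_le_log (by positivity) ?_).trans hlog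
    rw [le_div_iff₀ hδ]
    have e1 : (1 : ℝ) ≤ nS * nA := one_le_mul_of_one_le_of_one_le h1 h2
    have e2 : (m : ℝ) ≤ nS * nA * m := le_mul_of_one_le_left (by linarith) e1
    have e3 : 2 * (m : ℝ) * δ ≤ 2 * m * 1 :=
      mul_le_mul_of_nonneg_left hadm.δ_lt_one.le (by positivity)
    linarith

end SampleComplexity

/-! ### Transfer to the ground MDP and conclusion. -/

/-- A step whose policy is `ε`-optimal in the abstract MDP is successful. -/
lemma HasBoundedSuboptimality.successfulStep {SG SA A : Type*} [Fintype SG] [Fintype SA]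
    [Fintype A] [DecidableEq SG] [DecidableEq SA] [DecidableEq A] {M : MDP SG A}
    {α : StateAbstraction SG SA} {g : ℝ → ℝ} {η ε : ℝ} (h : HasBoundedSuboptimality M α g η)
    (hε : ε ≤ g η) {π : SA → A} {x : SA}
    (hx : (M.abstract α).optValue x - (M.abstract α).value (detPolicy π) x ≤ ε) :
    SuccessfulStep M α ε (3 * g η) π x := by
  refine ⟨hx, fun s hs => ?_⟩
  subst hs
  have hπ : IsPolicy (detPolicy π) := fun x =>
    ⟨fun u => by unfold detPolicy; rw [Pi.single_apply]; split_ifs <;> norm_num,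
      by simp [detPolicy]⟩
  have h1 := (abs_le.1 (h.optimal s)).2
  have h2 := (abs_le.1 (h.policy _ hπ s)).1
  have h3 : M.value (detPolicy fun s => π (α.φ s)) s =
      M.value (fun s => detPolicy π (α.φ s)) s := rfl
  linarith

theorem lemma1 :
    -- the constant and the exponent of the logarithm in `Õ`
    ∃ (C : ℝ) (k : ℕ), 0 < C ∧
    ∀ (nS nA : ℕ) (ε δ γ : ℝ), 1 ≤ nS → 1 ≤ nA → 0 < ε → ε ≤ 1 → 0 < δ → δ < 1 →
      0 ≤ γ → γ < 1 →
    -- the algorithmic constant `m`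
    ∃ m : ℕ, 1 ≤ m ∧
      (m : ℝ) ≤ C * logFactor nS nA ε δ γ ^ k * (nS / (ε ^ 2 * (1 - γ) ^ 4)) ∧
    ∀ (SG SA A : Type*) [Fintype SG] [Fintype SA] [Fintype A]
      [DecidableEq SG] [DecidableEq SA] [DecidableEq A]
      (M : MDP SG A) (α : StateAbstraction SG SA) (f : SG → A → ℝ) (g : ℝ → ℝ) (η : ℝ)
      (tie : SA → (A → ℝ) → A)
      (Ω : Type*) [MeasurableSpace Ω] (P : MeasureTheory.Measure Ω)
      [MeasureTheory.IsProbabilityMeasure P]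
      (s : ℕ → Ω → SA) (a : ℕ → Ω → A) (π : ℕ → Ω → SA → A) (p : ℝ),
      Fintype.card SA = nS → Fintype.card A = nA → M.γ = γ →
      0 < η → IsApproxAbstraction α.φ f η → HasBoundedSuboptimality M α g η → ε ≤ g η →
      IsGreedyRule tie → 0 < p →
      -- `p < 1`
      (p < 1 →
        (IsMBIEEBRun P (M.abstract α) (Real.sqrt p * mbieBeta nS nA m δ γ) m tie s a π →
          1 - δ / 2 - (nS * nA * m : ℝ) * (δ / (2 * nS * nA * m)) ^ p ≤
            P.real {ω | AllButAtMost
              (C * logFactor nS nA ε δ γ ^ k * (nS ^ 2 * nA / (ε ^ 3 * (1 - γ) ^ 6)))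
              fun t => SuccessfulStep M α ε (3 * g η) (π t ω) (s t ω)}) ∧
        1 - δ / 2 - (nS * nA * m : ℝ) * (δ / (2 * nS * nA * m)) ^ p < 1 - δ) ∧
      -- `p ≥ 1`, where `p = 1` is MBIE-EB itself
      (1 ≤ p →
        IsMBIEEBRun P (M.abstract α) (Real.sqrt p * mbieBeta nS nA m δ γ) ⌈p * m⌉₊ tie s a π →
        1 - δ ≤
          P.real {ω | AllButAtMost
            (p * (C * logFactor nS nA ε δ γ ^ k * (nS ^ 2 * nA / (ε ^ 3 * (1 - γ) ^ 6))))
            fun t => SuccessfulStep M α ε (3 * g η) (π t ω) (s t ω)}) := by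
  -- The constant is 540 · 4001 · 8: total cost, rounded cap, and division by ε(1 - γ)/8. The
  -- exponent 3 combines ℓ² from the cap with one ℓ from the cost.
  refine ⟨17284320, 3, by norm_num, fun nS nA ε δ γ hS hA hε hε1 hδ hδ1 hγ hγ1 => ?_⟩
  have hadm : IsAdmissible nS nA ε δ γ := ⟨hS, hA, hε, hε1, hδ, hδ1, hγ, hγ1⟩
  have hm := hadm.sampleCap_ge
  have h1 := hadm.one_le_nS'
  have h2 := hadm.one_le_nA'
  have hm1 : (1 : ℝ) ≤ sampleCap nS nA ε δ γ := by linarith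
  refine ⟨sampleCap nS nA ε δ γ, by exact_mod_cast hm1, ?_, ?_⟩
  · have hℓ := hadm.one_le_logFactor
    have hw := hadm.one_sub_pos
    refine hadm.sampleCap_le.trans ?_
    rw [← mul_assoc]
    gcongr
    · norm_num
    · norm_num
  intro SG SA A _ _ _ _ _ _ M α f g η tie Ω _ P _ s a π p hnS hnA hMγ _ _ hsub hεg htie hp
  subst hMγ
  have hQ : ∀ t ω, (M.abstract α).optValue (s t ω) -
      (M.abstract α).value (detPolicy (π t ω)) (s t ω) ≤ ε →
      SuccessfulStep M α ε (3 * g η) (π t ω) (s t ω) := fun t ω => hsub.successfulStep hεg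
  refine ⟨fun hp1 => ⟨fun hrun => ?_, ?_⟩, fun hp1 hrun => ?_⟩
  · have hmax : max p 1 = 1 := max_eq_right hp1.le
    have hceil : ⌈max p 1 * (sampleCap nS nA ε δ M.γ : ℝ)⌉₊ = sampleCap nS nA ε δ M.γ := by
      rw [hmax, one_mul, Nat.ceil_natCast]
    have := IsMBIEEBRun.measureReal_allButAtMost_ge (M := M.abstract α) hp hadm
      hceil.symm hnS hnA hrun htie hQ
    rw [show (M.abstract α).γ = M.γ from rfl, hmax, one_mul] at this
    linarith
  -- For p = 1 the subtracted term would be exactly N/2 · δ/N = δ/2; a base in (0, 1) makes it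
  -- strictly larger when p < 1.
  · set N : ℝ := 2 * nS * nA * sampleCap nS nA ε δ M.γ with hN
    have hN0 : 0 < N := by positivity
    have hlt : δ / N < (δ / N) ^ p := by
      conv_lhs => rw [← Real.rpow_one (δ / N)]
      refine Real.rpow_lt_rpow_of_exponent_gt (by positivity) ?_ hp1
      rw [div_lt_one hN0, hN]
      have : (1 : ℝ) ≤ nS * nA := one_le_mul_of_one_le_of_one_le h1 h2
      nlinarith
    have heq : (nS * nA * sampleCap nS nA ε δ M.γ : ℝ) = N / 2 := by rw [hN]; ring
    have := mul_lt_mul_of_pos_left hlt (half_pos hN0)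
    have h4 : N / 2 * (δ / N) = δ / 2 := by field_simp
    rw [heq]
    linarith
  -- Here the missing-optimism term is at most 3δ/4, which together with δ/4 gives δ.
  · have hmax : max p 1 = p := max_eq_left hp1
    have := IsMBIEEBRun.measureReal_allButAtMost_ge (M := M.abstract α) hp hadm
      (c := ⌈p * (sampleCap nS nA ε δ M.γ : ℝ)⌉₊) (by rw [hmax]; rfl) hnS hnA hrun htie hQ
    rw [show (M.abstract α).γ = M.γ from rfl, hmax] at this
    linarith [hadm.optimism_failure_le hp1]

end
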